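/- A SAS$^+$ instance is a tuple $\Pi=\langle V,D,A,I,G\rangle$, where $V$ is a finite set of variables, $D$ a finite domain, $A$ a finite set of actions, $I\in D^V$ the initial state and $G\in(D\cup\{\mathbf u\})^V$ the goal, $\mathbf u\notin D$ being the undefined value. Each action $a\in A$ has a precondition $\mathrm{pre}(a)$ and an effect $\mathrm{eff}(a)$ in $(D\cup\{\mathbf u\})^V$. It is valid in a state $s\in D^V$ if $\mathrm{pre}(a)[v]\in\{s[v],\mathbf u\}$ for all $v\in V$, and its result in $s$ is the state $t$ with $t[v]=\mathrm{eff}(a)[v]$ if $\mathrm{eff}(a)[v]\ne\mathbf u$ and $t[v]=s[v]$ otherwise. A plan for $\Pi$ is a finite (possibly empty) sequence of actions that, starting in $I$, are successively valid and lead to a state $s$ with $G[v]\in\{s[v],\mathbf u\}$ for all $v\in V$. Restriction P says that for each $v\in V$ and each $x\in D$ there is at most one $a\in A$ with $\mathrm{eff}(a)[v]=x$. Theorem. Consider the following problem: given a SAS$^+$ instance $\Pi$ that satisfies restriction P and a positive integer $k$, does $\Pi$ have a plan of length at most $k$? Parameterized by $k$, this problem is fixed-parameter tractable: there are a computable function $f$,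 a constant $c$ and an algorithm that solves every instance $\langle\Pi,k\rangle$ of size $n$ in time $f(k)\,n^c$. Moreover, one may take $f(k)=2\cdot 2^{(k+2)^2}(k+2)^{(k+1)^2}$ (for a suitable constant $c$). -/

import Mathlib

/-! ### Parameterized problems and fixed-parameter tractability -/

/-- A parameterized decision problem: its instances, the parameter of an instance, the set of
yes-instances, and the words over an alphabet by which instances are presented to machines. -/
structure ParamProblem where
  /-- the instances -/
  Instance : Type
  /-- the parameter of an instance -/
  param : Instance → ℕ
  /-- the yes-instances -/
  Yes : Instance → Prop
  /-- the input alphabet -/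
  Symbol : Type
  /-- the word that presents an instance -/
  encode : Instance → List Symbol
  encode_injective : Function.Injective encode

namespace ParamProblem

/-- The size of an instance: the length of the word that presents it. -/
def size (L : ParamProblem) (x : L.Instance) : ℕ := (L.encode x).length

/-- The restriction of a problem to those instances that satisfy `R`. -/
def restrict (L : ParamProblem) (R : L.Instance → Prop) : ParamProblem where
  Instance := {x : L.Instance // R x}
  param x := L.param x.1
  Yes x := L.Yes x.1
  Symbol := L.Symbol
  encode x := L.encode x.1
  encode_injective _ _ h := Subtype.ext (L.encode_injective h)

/-- Some (multi-stack) Turing machine, started on the word of an instance `x`, halts after at most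
`t x` steps with the one-letter output `true` if `x` is a yes-instance and `false` otherwise. -/
def SolvableInTime (L : ParamProblem) (t : L.Instance → ℕ) : Prop :=
  ∃ M : Turing.TM2ComputableAux L.Symbol Bool, ∀ x : L.Instance, ∃ b : Bool,
    (b = true ↔ L.Yes x) ∧
      Nonempty (Turing.TM2OutputsInTime M.tm
        ((L.encode x).map M.inputAlphabet.symm)
        (some ([b].map M.outputAlphabet.symm)) (t x))

/-- The problem is solvable in time `f(k) * n ^ c` for a constant `c`, where `k` is the parameter
and `n` the size of the instance. -/
def SolvableInFPTTime (L : ParamProblem) (f : ℕ → ℕ) : Prop :=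
  ∃ c : ℕ, L.SolvableInTime fun x => f (L.param x) * L.size x ^ c

/-- Fixed-parameter tractability: solvable in time `f(k) * n ^ c` for some computable `f` and some
constant `c`. -/
def InFPT (L : ParamProblem) : Prop :=
  ∃ f : ℕ → ℕ, Computable f ∧ L.SolvableInFPTTime f

end ParamProblem

/-! ### Planning in SAS+ -/

/-- A SAS+ instance. The variables, the values and the actions are numbered; `none` is the undefined
value. Distinct actions may have the same precondition and effect. -/
structure SASPlus where
  /-- number of variables -/
  numVars : ℕ
  /-- number of values in the domain -/
  domSize : ℕ
  /-- number of actions -/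
  numActs : ℕ
  /-- preconditions of the actions -/
  pre : Fin numActs → Fin numVars → Option (Fin domSize)
  /-- effects of the actions -/
  eff : Fin numActs → Fin numVars → Option (Fin domSize)
  /-- initial state -/
  init : Fin numVars → Fin domSize
  /-- goal -/
  goal : Fin numVars → Option (Fin domSize)

namespace SASPlus

/-- Total states. -/
abbrev State (I : SASPlus) : Type := Fin I.numVars → Fin I.domSize

/-- Action `a` is valid in state `s`. -/
def Valid (I : SASPlus) (a : Fin I.numActs) (s : I.State) : Prop :=
  ∀ v, I.pre a v = some (s v) ∨ I.pre a v = none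

/-- The result of action `a` in state `s`. -/
def result (I : SASPlus) (a : Fin I.numActs) (s : I.State) : I.State :=
  fun v => (I.eff a v).getD (s v)

/-- The action sequence is a plan from the first state to the second. -/
def IsPlanFromTo (I : SASPlus) : I.State → List (Fin I.numActs) → I.State → Prop
  | s, [], t => s = t
  | s, a :: p, t => I.Valid a s ∧ I.IsPlanFromTo (I.result a s) p t

/-- Goal states. -/
def IsGoalState (I : SASPlus) (s : I.State) : Prop :=
  ∀ v, I.goal v = some (s v) ∨ I.goal v = none

/-- The action sequence is a plan for the instance. -/
def IsPlan (I : SASPlus) (p : List (Fin I.numActs)) : Prop :=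
  ∃ s, I.IsGoalState s ∧ I.IsPlanFromTo I.init p s

/-- Restriction P: for each variable `v` and each value `x` there is at most one action with effect
`v = x`. -/
def RestrictionP (I : SASPlus) : Prop :=
  ∀ (v : Fin I.numVars) (x : Fin I.domSize) (a b : Fin I.numActs),
    I.eff a v = some x → I.eff b v = some x → a = b

end SASPlus

/-! ### Instances as words -/

/-- The input alphabet: binary digits, the undefined value, and two end markers. -/
inductive PlanSymbol : Type
  | bit (b : Bool)
  | undef
  | endValue
  | endBlock

namespace PlanSymbol

/-- A number in binary. -/
def natCode (m : ℕ) : List PlanSymbol := (Computability.encodeNat m).map bit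

/-- A value or the undefined value, with an end marker. -/
def valueCode : Option ℕ → List PlanSymbol
  | none => [undef, endValue]
  | some m => natCode m ++ [endValue]

/-- A sequence of values, with an end marker. -/
def blockCode (l : List (Option ℕ)) : List PlanSymbol := l.flatMap valueCode ++ [endBlock]

/-- A partial state: the values of all variables, in order. -/
def stateCode {n d : ℕ} (s : Fin n → Option (Fin d)) : List PlanSymbol :=
  blockCode (List.ofFn fun v => (s v).map Fin.val)

/-- A pair of a SAS+ instance and a number `k`: `k` and the domain size in binary, the initial
state, the goal, and precondition and effect of each action. -/
def planCode (I : SASPlus) (k : ℕ) : List PlanSymbol :=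
  blockCode [some k] ++ (blockCode [some I.domSize] ++
    (stateCode (fun v => some (I.init v)) ++ (stateCode I.goal ++
      (List.ofFn fun a => stateCode (I.pre a) ++ stateCode (I.eff a)).flatten)))

theorem append_cons_inj {α : Type} {m : α} :
    ∀ {l l' : List α} {r r' : List α}, m ∉ l → m ∉ l' →
      l ++ m :: r = l' ++ m :: r' → l = l' ∧ r = r'
  | [], [], _, _, _, _, h => by simpa using h
  | [], b :: l', _, _, _, h2, h => by
      simp only [List.nil_append, List.cons_append, List.cons.injEq] at h
      exact absurd (by simp [h.1]) h2
  | a :: l, [], _, _, h1, _, h => by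
      simp only [List.nil_append, List.cons_append, List.cons.injEq] at h
      exact absurd (by simp [h.1]) h1
  | a :: l, b :: l', _, _, h1, h2, h => by
      simp only [List.cons_append, List.cons.injEq] at h
      simp only [List.mem_cons, not_or] at h1 h2
      have := append_cons_inj h1.2 h2.2 h.2
      exact ⟨by rw [h.1, this.1], this.2⟩

theorem natCode_injective : Function.Injective natCode := by
  intro a b h
  have h1 := List.map_injective_iff.2 (fun x y (e : bit x = bit y) => by injection e) h
  have h2 := congrArg Computability.decodeNat h1
  simpa [Computability.decode_encodeNat] using h2

theorem endValue_notMem_natCode (m : ℕ) : endValue ∉ natCode m := by simp [natCode]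

theorem endBlock_notMem_valueCode (o : Option ℕ) : endBlock ∉ valueCode o := by
  cases o <;> simp [valueCode, natCode]

theorem undef_notMem_natCode (m : ℕ) : undef ∉ natCode m := by simp [natCode]

theorem valueCode_append_inj {o o' : Option ℕ} {r r' : List PlanSymbol}
    (h : valueCode o ++ r = valueCode o' ++ r') : o = o' ∧ r = r' := by
  obtain ⟨w, hw, hw'⟩ : ∃ w, valueCode o = w ++ [endValue] ∧ endValue ∉ w ∧
      ((o = none ∧ w = [undef]) ∨ ∃ m, o = some m ∧ w = natCode m) := by
    cases o with
    | none => exact ⟨[undef], rfl, by simp, Or.inl ⟨rfl, rfl⟩⟩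
    | some m => exact ⟨natCode m, rfl, endValue_notMem_natCode m, Or.inr ⟨m, rfl, rfl⟩⟩
  obtain ⟨u, hu, hu'⟩ : ∃ w, valueCode o' = w ++ [endValue] ∧ endValue ∉ w ∧
      ((o' = none ∧ w = [undef]) ∨ ∃ m, o' = some m ∧ w = natCode m) := by
    cases o' with
    | none => exact ⟨[undef], rfl, by simp, Or.inl ⟨rfl, rfl⟩⟩
    | some m => exact ⟨natCode m, rfl, endValue_notMem_natCode m, Or.inr ⟨m, rfl, rfl⟩⟩
  rw [hw, hu, List.append_assoc, List.append_assoc] at h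
  obtain ⟨e, e'⟩ := append_cons_inj hw'.1 hu'.1 h
  refine ⟨?_, e'⟩
  rcases hw'.2 with ⟨h1, h2⟩ | ⟨m, h1, h2⟩ <;> rcases hu'.2 with ⟨h3, h4⟩ | ⟨m', h3, h4⟩
  · rw [h1, h3]
  · exact absurd (by rw [← h4, ← e, h2]; simp) (undef_notMem_natCode m')
  · exact absurd (by rw [← h2, e, h4]; simp) (undef_notMem_natCode m)
  · rw [h1, h3, natCode_injective (h2.symm.trans (e.trans h4))]

theorem flatMap_valueCode_injective :
    ∀ {l l' : List (Option ℕ)}, l.flatMap valueCode = l'.flatMap valueCode → l = l'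
  | [], [], _ => rfl
  | [], b :: l', h => by cases b <;> simp [valueCode] at h
  | a :: l, [], h => by cases a <;> simp [valueCode] at h
  | a :: l, b :: l', h => by
      simp only [List.flatMap_cons] at h
      obtain ⟨e, e'⟩ := valueCode_append_inj h
      rw [e, flatMap_valueCode_injective e']

theorem blockCode_append_inj {l l' : List (Option ℕ)} {r r' : List PlanSymbol}
    (h : blockCode l ++ r = blockCode l' ++ r') : l = l' ∧ r = r' := by
  simp only [blockCode, List.append_assoc] at h
  have hn : ∀ l : List (Option ℕ), endBlock ∉ l.flatMap valueCode := by
    intro l hl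
    obtain ⟨o, -, ho⟩ := List.mem_flatMap.1 hl
    exact endBlock_notMem_valueCode o ho
  obtain ⟨e, e'⟩ := append_cons_inj (hn l) (hn l') h
  exact ⟨flatMap_valueCode_injective e, e'⟩

theorem stateCode_append_inj {n d : ℕ} {s t : Fin n → Option (Fin d)} {r r' : List PlanSymbol}
    (h : stateCode s ++ r = stateCode t ++ r') : s = t ∧ r = r' := by
  obtain ⟨e, e'⟩ := blockCode_append_inj h
  refine ⟨funext fun v => ?_, e'⟩
  exact Option.map_injective Fin.val_injective (congrFun (List.ofFn_injective e) v)

theorem flatten_actions_inj {n d : ℕ} :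
    ∀ {l l' : List ((Fin n → Option (Fin d)) × (Fin n → Option (Fin d)))},
      (l.map fun p => stateCode p.1 ++ stateCode p.2).flatten =
        (l'.map fun p => stateCode p.1 ++ stateCode p.2).flatten → l = l'
  | [], [], _ => rfl
  | [], b :: l', h => by simp [stateCode, blockCode] at h
  | a :: l, [], h => by simp [stateCode, blockCode] at h
  | a :: l, b :: l', h => by
      simp only [List.map_cons, List.flatten_cons, List.append_assoc] at h
      obtain ⟨e1, h⟩ := stateCode_append_inj h
      obtain ⟨e2, h⟩ := stateCode_append_inj h
      rw [flatten_actions_inj h, Prod.ext e1 e2]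

theorem planCode_inj {I J : SASPlus} {k m : ℕ} (h : planCode I k = planCode J m) :
    I = J ∧ k = m := by
  unfold planCode at h
  obtain ⟨hk, h1⟩ := blockCode_append_inj h
  obtain ⟨hd, h2⟩ := blockCode_append_inj h1
  clear h h1
  obtain ⟨n, d, a, pre, eff, init, goal⟩ := I
  obtain ⟨n', d', a', pre', eff', init', goal'⟩ := J
  obtain rfl : d = d' := by simpa using hd
  obtain rfl : k = m := by simpa using hk
  obtain rfl : n = n' := by
    have := congrArg List.length (blockCode_append_inj h2).1
    rwa [List.length_ofFn, List.length_ofFn] at this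
  obtain ⟨hi, h3⟩ := stateCode_append_inj h2
  obtain ⟨rfl, h⟩ := stateCode_append_inj h3
  obtain rfl : init = init' := funext fun v => Option.some_injective _ (congrFun hi v)
  have e : List.ofFn (fun i => (pre i, eff i)) = List.ofFn (fun i => (pre' i, eff' i)) := by
    apply flatten_actions_inj
    simpa [List.map_ofFn, Function.comp_def] using h
  obtain rfl : a = a' := by
    have := congrArg List.length e
    rwa [List.length_ofFn, List.length_ofFn] at this
  have e' := List.ofFn_injective e
  obtain rfl : pre = pre' := funext fun i => congrArg Prod.fst (congrFun e' i)
  obtain rfl : eff = eff' := funext fun i => congrArg Prod.snd (congrFun e' i)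
  exact ⟨rfl, rfl⟩

end PlanSymbol

/-! ### The problem -/

/-- Bounded SAS+ plan existence: given a SAS+ instance and a positive integer `k`, the parameter,
is there a plan of length at most `k`? -/
def boundedPlanExistence : ParamProblem where
  Instance := {x : SASPlus × ℕ // 0 < x.2}
  param x := x.1.2
  Yes x := ∃ p : List (Fin x.1.1.numActs), x.1.1.IsPlan p ∧ p.length ≤ x.1.2
  Symbol := PlanSymbol
  encode x := PlanSymbol.planCode x.1.1 x.1.2
  encode_injective _ _ h :=
    Subtype.ext (Prod.ext (PlanSymbol.planCode_inj h).1 (PlanSymbol.planCode_inj h).2)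

/-- Bounded SAS+ plan existence on the instances that satisfy restriction P. -/
def boundedPlanExistenceP : ParamProblem :=
  boundedPlanExistence.restrict fun x => x.1.1.RestrictionP

/-! The algorithm is a bounded search tree. Let `S` be a subsequence of a plan `p` that is not
itself a plan. Run `S` up to its first violated condition, which is a precondition of one of its
actions or the goal, and let `v = x` be a value demanded there and not present. At the corresponding
point of `p` the value is present. Hence the last action of `p` before that point which affects `v`
sets it to `x`, and `S` omits this action, since otherwise `S` would have the value as well.
Inserting it at its place in `S` gives a longer subsequence of `p` (`SASPlus.exists_insert`). By
restriction P it is the only action with effect `v = x`, so it is known without knowing `p`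
(`RestrictionP.exists_insert`). Only the place is unknown, and a sequence of length `m` offers `m +
1` places.

The search starts from the empty sequence. It picks one action that achieves some missing value and
tries all places. Level `m` consists of sequences of length `m`. As long as no plan has been met, it
contains a subsequence of `p` (`exists_mem_levelActs`), which at level `p.length` is `p` itself. So
a plan of length at most `k` exists exactly if levels `0, ..., k` contain a plan
(`exists_levelActs_iff`), and each level `m ≤ k + 1` has at most `(k + 2) ^ m` sequences.

The time bound is proved for actual multi-stack machines. Structured stack programs are compiled to
machines (`Exec.steps`), and data are binary trees written in preorder on the stacks. `FTime μ F`
says that a program computes `F` in time polynomial in the size of the argument plus an allowance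
`μ`. This notion is closed under composition with polynomial-time functions, pairing, branching, and
folds whose intermediate results stay small. With the allowance `(k + 2) ^ (k + 1)` all levels are
small, so the running time is at most `(n ^ 4 * (k + 2) ^ (k + 1)) ^ c`. The exponent `c` on the
parameter part is harmless. For `c ≤ k + 1` it is covered by the exponent `(k + 1) ^ 2` in `f`. For
`c > k + 1` that part is bounded by a constant, which a power of `n` absorbs (`pow_le_bound`). -/

/-! ### Structured programs for machines with several stacks -/

/-- A structured program acting on stacks. Tests look at the top symbol of a stack. -/
inductive StackProg {K : Type} (Γ : K → Type) : Type
  | push (k : K) (a : Γ k)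
  | pop (k : K)
  | seq (p q : StackProg Γ)
  | ite (k : K) (c : Option (Γ k) → Bool) (p q : StackProg Γ)
  | loop (k : K) (c : Option (Γ k) → Bool) (p : StackProg Γ)

namespace StackProg

open Turing

variable {K : Type} {Γ : K → Type}

/-- The control points of a program. -/
def Label : StackProg Γ → Type
  | push _ _ => Unit
  | pop _ => Unit
  | seq p q => p.Label ⊕ q.Label
  | ite _ _ p q => Option (p.Label ⊕ q.Label)
  | loop _ _ p => Option p.Label

instance fintypeLabel : (p : StackProg Γ) → Fintype p.Label
  | push _ _ => inferInstanceAs (Fintype Unit)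
  | pop _ => inferInstanceAs (Fintype Unit)
  | seq p q =>
    letI := fintypeLabel p
    letI := fintypeLabel q
    inferInstanceAs (Fintype (p.Label ⊕ q.Label))
  | ite _ _ p q =>
    letI := fintypeLabel p
    letI := fintypeLabel q
    inferInstanceAs (Fintype (Option (p.Label ⊕ q.Label)))
  | loop _ _ p =>
    letI := fintypeLabel p
    inferInstanceAs (Fintype (Option p.Label))

/-- The control point at which a program starts. -/
def entry : (p : StackProg Γ) → p.Label
  | push _ _ => ()
  | pop _ => ()
  | seq p _ => Sum.inl p.entry
  | ite _ _ _ _ => none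
  | loop _ _ _ => none

/-- Test the top of stack `k` and go to `l₁` or `l₂`. -/
def testStmt {Λ : Type} (k : K) (c : Option (Γ k) → Bool) (l₁ l₂ : Λ) : TM2.Stmt Γ Λ Bool :=
  .peek k (fun _ o => c o) (.branch id
    -- The register returns to `false`, so that every statement starts from the internal state that
    -- `Exec.steps` assumes.
    (.load (fun _ => false) (.goto fun _ => l₁)) (.load (fun _ => false) (.goto fun _ => l₂)))

/-- The machine statements at the control points of a program, where control points are embedded
into labels by `f` and the program continues at label `exit`. -/
def stmt {Λ : Type} : (p : StackProg Γ) → (f : p.Label → Λ) → (exit : Λ) → p.Label →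
    TM2.Stmt Γ Λ Bool
  | push k a, _, exit, _ => .push k (fun _ => a) (.goto fun _ => exit)
  | pop k, _, exit, _ => .pop k (fun v _ => v) (.goto fun _ => exit)
  | seq p q, f, exit, l => match l with
    | .inl l => p.stmt (fun l => f (.inl l)) (f (.inr q.entry)) l
    | .inr l => q.stmt (fun l => f (.inr l)) exit l
  | ite k c p q, f, exit, l => match l with
    | none => testStmt k c (f (some (.inl p.entry))) (f (some (.inr q.entry)))
    | some (.inl l) => p.stmt (fun l => f (some (.inl l))) exit l
    | some (.inr l) => q.stmt (fun l => f (some (.inr l))) exit l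
  | loop k c p, f, exit, l => match l with
    | none => testStmt k c (f (some p.entry)) exit
    | some l => p.stmt (fun l => f (some l)) (f none) l

variable [DecidableEq K]

/-- `p.Exec s t n`: started on the stacks `s`, the program `p` ends with the stacks `t` after at
most `n` steps. -/
inductive Exec : StackProg Γ → (∀ k, List (Γ k)) → (∀ k, List (Γ k)) → ℕ → Prop
  | push (k : K) (a : Γ k) (s) : Exec (.push k a) s (Function.update s k (a :: s k)) 1
  | pop (k : K) (s) : Exec (.pop k) s (Function.update s k (s k).tail) 1
  | seq {p q s t u m n} : Exec p s t m → Exec q t u n → Exec (.seq p q) s u (m + n)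
  | ite_true {k c p q s t n} : c (s k).head? = true → Exec p s t n →
      Exec (.ite k c p q) s t (n + 1)
  | ite_false {k c p q s t n} : c (s k).head? = false → Exec q s t n →
      Exec (.ite k c p q) s t (n + 1)
  | loop_exit {k c p s} : c (s k).head? = false → Exec (.loop k c p) s s 1
  | loop_step {k c p s t u m n} : c (s k).head? = true → Exec p s t m →
      Exec (.loop k c p) t u n → Exec (.loop k c p) s u (m + n + 1)
  | mono {p s t m n} : Exec p s t m → m ≤ n → Exec p s t n

/-- `n` steps of a machine. -/
def steps {Λ : Type} (M : Λ → TM2.Stmt Γ Λ Bool) (n : ℕ) :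
    Option (TM2.Cfg Γ Λ Bool) → Option (TM2.Cfg Γ Λ Bool) :=
  (flip bind (TM2.step M))^[n]

theorem steps_add {Λ : Type} (M : Λ → TM2.Stmt Γ Λ Bool) {m n : ℕ}
    {a b c : Option (TM2.Cfg Γ Λ Bool)} (h : steps M m a = b) (h' : steps M n b = c) :
    steps M (m + n) a = c := by
  rw [steps, add_comm, Function.iterate_add_apply]
  change steps M n (steps M m a) = c
  rw [h, h']

theorem steps_one_test {Λ : Type} {M : Λ → TM2.Stmt Γ Λ Bool} {k : K} {c : Option (Γ k) → Bool}
    {l l₁ l₂ : Λ} (h : M l = testStmt k c l₁ l₂) (s : ∀ k, List (Γ k)) :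
    steps M 1 (some ⟨some l, false, s⟩) =
      some ⟨some (cond (c (s k).head?) l₁ l₂), false, s⟩ := by
  simp only [steps, Function.iterate_one, flip]
  change TM2.step M ⟨some l, false, s⟩ = _
  rw [TM2.step, h, testStmt]
  cases hc : c (s k).head? <;> simp [TM2.stepAux, hc]

/-- A machine that contains the statements of a program runs this program. -/
theorem Exec.steps {p : StackProg Γ} {s t : ∀ k, List (Γ k)} {n : ℕ} (h : p.Exec s t n) :
    ∀ {Λ : Type} (M : Λ → TM2.Stmt Γ Λ Bool) (f : p.Label → Λ) (exit : Λ),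
      (∀ l, M (f l) = p.stmt f exit l) →
      ∃ m ≤ n, steps M m (some ⟨some (f p.entry), false, s⟩) = some ⟨some exit, false, t⟩ := by
  induction h with
  | push k a s =>
    intro Λ M f exit hM
    refine ⟨1, le_rfl, ?_⟩
    change TM2.step M ⟨some (f _), false, s⟩ = _
    rw [TM2.step, hM]
    rfl
  | pop k s =>
    intro Λ M f exit hM
    refine ⟨1, le_rfl, ?_⟩
    change TM2.step M ⟨some (f _), false, s⟩ = _
    rw [TM2.step, hM]
    rfl
  | @seq p q s t u m n _ _ ih₁ ih₂ =>
    intro Λ M f exit hM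
    obtain ⟨m', hm, e⟩ := ih₁ M (fun l => f (.inl l)) (f (.inr q.entry)) fun l => hM (.inl l)
    obtain ⟨n', hn, e'⟩ := ih₂ M (fun l => f (.inr l)) exit fun l => hM (.inr l)
    exact ⟨m' + n', by omega, steps_add M e e'⟩
  | @ite_true k c p q s t n hc _ ih =>
    intro Λ M f exit hM
    obtain ⟨m, hm, e⟩ := ih M (fun l => f (some (.inl l))) exit fun l => hM (some (.inl l))
    have h1 := steps_one_test (hM none) s
    rw [hc] at h1
    exact ⟨1 + m, by omega, steps_add M h1 e⟩
  | @ite_false k c p q s t n hc _ ih =>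
    intro Λ M f exit hM
    obtain ⟨m, hm, e⟩ := ih M (fun l => f (some (.inr l))) exit fun l => hM (some (.inr l))
    have h1 := steps_one_test (hM none) s
    rw [hc] at h1
    exact ⟨1 + m, by omega, steps_add M h1 e⟩
  | @loop_exit k c p s hc =>
    intro Λ M f exit hM
    have h1 := steps_one_test (hM none) s
    rw [hc] at h1
    exact ⟨1, le_rfl, h1⟩
  | @loop_step k c p s t u m n hc _ _ ih₁ ih₂ =>
    intro Λ M f exit hM
    have h1 := steps_one_test (hM none) s
    rw [hc] at h1
    obtain ⟨m', hm, e⟩ := ih₁ M (fun l => f (some l)) (f none) fun l => hM (some l)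
    obtain ⟨n', hn, e'⟩ := ih₂ M f exit hM
    exact ⟨1 + m' + n', by omega, steps_add M (steps_add M h1 e) e'⟩
  | mono _ hmn ih =>
    intro Λ M f exit hM
    obtain ⟨m, hm, e⟩ := ih M f exit hM
    exact ⟨m, hm.trans hmn, e⟩

/-- The machine that runs a program and halts. -/
def toTM2 [Fintype K] (p : StackProg Γ) (k₀ k₁ : K) [Fintype (Γ k₀)] : FinTM2 where
  K := K
  k₀ := k₀
  k₁ := k₁
  Γ := Γ
  Λ := Option p.Label
  main := some p.entry
  σ := Bool
  initialState := false
  m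
    | none => .halt
    | some l => p.stmt some none l

/-- `initList` and `haltList` describe the stacks by the case distinction on the left. -/
theorem dite_eq_update (k₀ : K) (w : List (Γ k₀)) :
    (fun k => if h : k = k₀ then (by rw [h]; exact w) else []) =
      Function.update (fun k => ([] : List (Γ k))) k₀ w := by
  funext k
  by_cases hk : k = k₀
  · subst hk
    simp
  · simp [hk]

theorem Exec.evalsTo [Fintype K] {p : StackProg Γ} {k₀ k₁ : K} [Fintype (Γ k₀)]
    {w : List (Γ k₀)} {v : List (Γ k₁)} {n : ℕ}
    (h : p.Exec (Function.update (fun _ => []) k₀ w) (Function.update (fun _ => []) k₁ v) n) :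
    Nonempty (TM2OutputsInTime (p.toTM2 k₀ k₁) w (some v) (n + 1)) := by
  obtain ⟨m, hm, e⟩ := h.steps (p.toTM2 k₀ k₁).m some none fun l => rfl
  -- The additional step executes the halt statement at the exit label.
  refine ⟨⟨⟨m + 1, ?_⟩, Nat.succ_le_succ hm⟩⟩
  have h2 : StackProg.steps (p.toTM2 k₀ k₁).m 1
      (some ⟨some none, false, Function.update (fun _ => []) k₁ v⟩) =
      some ⟨none, false, Function.update (fun _ => []) k₁ v⟩ := rfl
  have h3 := steps_add _ e h2
  have ha : initList (p.toTM2 k₀ k₁) w =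
      ⟨some (some p.entry), false, Function.update (fun _ => []) k₀ w⟩ :=
    congrArg (TM2.Cfg.mk (some (some p.entry)) false) (dite_eq_update k₀ w)
  have hb : haltList (p.toTM2 k₀ k₁) v =
      ⟨none, false, Function.update (fun _ => []) k₁ v⟩ :=
    congrArg (TM2.Cfg.mk none false) (dite_eq_update k₁ v)
  exact (congrArg (fun c => StackProg.steps (p.toTM2 k₀ k₁).m (m + 1) (some c)) ha).trans
    (h3.trans (congrArg some hb.symm))

end StackProg

/-! ### Binary trees on stacks -/

/-- Binary trees, the data type of the programs below. -/
inductive Bin : Type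
  | leaf
  | node (l r : Bin)

namespace Bin

/-- The nodes and leaves of a tree in preorder. -/
def code : Bin → List Bool
  | leaf => [false]
  | node l r => true :: (l.code ++ r.code)

/-- The length of the code of a tree. -/
def size : Bin → ℕ
  | leaf => 1
  | node l r => l.size + r.size + 1

@[simp] theorem length_code : ∀ t : Bin, t.code.length = t.size
  | leaf => rfl
  | node l r => by simp [code, size, length_code l, length_code r]

theorem size_pos : ∀ t : Bin, 0 < t.size
  | leaf => Nat.one_pos
  | node _ _ => Nat.succ_pos _

/-- Preorder codes are prefix-free: the code itself shows where a tree ends, so trees can be stacked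
without separators. -/
theorem code_append_inj : ∀ {s t : Bin} {a b : List Bool},
    s.code ++ a = t.code ++ b → s = t ∧ a = b
  | leaf, leaf, _, _, h => by simpa [code] using h
  | leaf, node _ _, _, _, h => by simp [code] at h
  | node _ _, leaf, _, _, h => by simp [code] at h
  | node _ _, node _ _, _, _, h => by
    simp only [code, List.cons_append, List.append_assoc, List.cons.injEq, true_and] at h
    obtain ⟨e₁, h⟩ := code_append_inj h
    obtain ⟨e₂, h⟩ := code_append_inj h
    exact ⟨by rw [e₁, e₂], h⟩

theorem code_injective {s t : Bin} (h : s.code = t.code) : s = t :=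
  (code_append_inj (a := []) (b := []) (by rw [h])).1

end Bin

/-- The stacks of the planning machine: the input, two stacks of trees and three stacks for
intermediate results. -/
inductive Stk : Type
  | inp | main | aux | tmp₁ | tmp₂ | cnt

namespace Stk

instance : DecidableEq Stk := fun a b => by
  cases a <;> cases b <;> first | exact isTrue rfl | exact isFalse (fun h => nomatch h)

instance : Fintype Stk := ⟨{inp, main, aux, tmp₁, tmp₂, cnt}, fun k => by cases k <;> simp⟩

/-- The stack alphabets. -/
@[reducible] def Sym : Stk → Type
  | inp => PlanSymbol
  | _ => Bool

/-- The contents of all stacks. -/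
def mk (i : List PlanSymbol) (a b t u c : List Bool) : ∀ k, List (Sym k)
  | inp => i
  | main => a
  | aux => b
  | tmp₁ => t
  | tmp₂ => u
  | cnt => c

variable {i i' : List PlanSymbol} {a b t u c x : List Bool}

theorem update_inp : Function.update (mk i a b t u c) inp i' = mk i' a b t u c := by
  funext k; cases k <;> rfl

theorem update_main : Function.update (mk i a b t u c) main x = mk i x b t u c := by
  funext k; cases k <;> rfl

theorem update_aux : Function.update (mk i a b t u c) aux x = mk i a x t u c := by
  funext k; cases k <;> rfl

theorem update_tmp₁ : Function.update (mk i a b t u c) tmp₁ x = mk i a b x u c := by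
  funext k; cases k <;> rfl

theorem update_tmp₂ : Function.update (mk i a b t u c) tmp₂ x = mk i a b t x c := by
  funext k; cases k <;> rfl

theorem update_cnt : Function.update (mk i a b t u c) cnt x = mk i a b t u x := by
  funext k; cases k <;> rfl

end Stk

open Stk StackProg

/-- Programs on the stacks `Stk`. -/
abbrev Prog := StackProg Stk.Sym

/-! ### Moving, copying and comparing trees on stacks -/

namespace Prog

variable {i : List PlanSymbol} {a b t u c w : List Bool} {y : Bool}

theorem pop_inp {y} : Exec (.pop inp) (mk (y :: i) a b t u c) (mk i a b t u c) 1 := by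
  have h := Exec.pop inp (mk (y :: i) a b t u c)
  rwa [update_inp] at h

theorem push_main : Exec (.push main y) (mk i a b t u c) (mk i (y :: a) b t u c) 1 := by
  have h := Exec.push main y (mk i a b t u c)
  rwa [update_main] at h

theorem pop_main : Exec (.pop main) (mk i (y :: a) b t u c) (mk i a b t u c) 1 := by
  have h := Exec.pop main (mk i (y :: a) b t u c)
  rwa [update_main] at h

theorem push_aux : Exec (.push aux y) (mk i a b t u c) (mk i a (y :: b) t u c) 1 := by
  have h := Exec.push aux y (mk i a b t u c)
  rwa [update_aux] at h

theorem pop_aux : Exec (.pop aux) (mk i a (y :: b) t u c) (mk i a b t u c) 1 := by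
  have h := Exec.pop aux (mk i a (y :: b) t u c)
  rwa [update_aux] at h

theorem push_tmp₁ : Exec (.push tmp₁ y) (mk i a b t u c) (mk i a b (y :: t) u c) 1 := by
  have h := Exec.push tmp₁ y (mk i a b t u c)
  rwa [update_tmp₁] at h

theorem pop_tmp₁ : Exec (.pop tmp₁) (mk i a b (y :: t) u c) (mk i a b t u c) 1 := by
  have h := Exec.pop tmp₁ (mk i a b (y :: t) u c)
  rwa [update_tmp₁] at h

theorem push_tmp₂ : Exec (.push tmp₂ y) (mk i a b t u c) (mk i a b t (y :: u) c) 1 := by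
  have h := Exec.push tmp₂ y (mk i a b t u c)
  rwa [update_tmp₂] at h

theorem pop_tmp₂ : Exec (.pop tmp₂) (mk i a b t (y :: u) c) (mk i a b t u c) 1 := by
  have h := Exec.pop tmp₂ (mk i a b t (y :: u) c)
  rwa [update_tmp₂] at h

theorem push_cnt : Exec (.push cnt y) (mk i a b t u c) (mk i a b t u (y :: c)) 1 := by
  have h := Exec.push cnt y (mk i a b t u c)
  rwa [update_cnt] at h

theorem pop_cnt : Exec (.pop cnt) (mk i a b t u (y :: c)) (mk i a b t u c) 1 := by
  have h := Exec.pop cnt (mk i a b t u (y :: c))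
  rwa [update_cnt] at h

/-- Is the top symbol `true`? -/
def isTrue (o : Option Bool) : Bool := o = some true

/-- Run `p` for every symbol of `tmp₁`, after its removal. -/
def drain (p : Bool → Prog) : Prog :=
  .loop tmp₁ Option.isSome
    (.ite tmp₁ isTrue (.seq (.pop tmp₁) (p true)) (.seq (.pop tmp₁) (p false)))

/-- The parameter `x` stands for whatever the body changes, so one induction serves all target
stacks. Each symbol costs two tests, one pop and two steps of the body. -/
theorem exec_drain {p : Bool → Prog} {α : Type} (g : Bool → α → α)
    (S : α → List Bool → ∀ k, List (Sym k)) (hS : ∀ x t, S x t tmp₁ = t)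
    (hpop : ∀ x y t, Exec (.pop tmp₁) (S x (y :: t)) (S x t) 1)
    (hp : ∀ x y t, Exec (p y) (S x t) (S (g y x) t) 2) :
    ∀ t x, Exec (drain p) (S x t) (S (t.foldl (fun x y => g y x) x) []) (5 * t.length + 1)
  | [], x => by
    refine .loop_exit ?_
    rw [hS]; rfl
  | y :: t, x => by
    have h1 : Exec (.ite tmp₁ isTrue (.seq (.pop tmp₁) (p true)) (.seq (.pop tmp₁) (p false)))
        (S x (y :: t)) (S (g y x) t) (1 + 2 + 1) := by
      cases y
      · exact .ite_false (by rw [hS]; rfl) (.seq (hpop _ _ _) (hp _ _ _))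
      · exact .ite_true (by rw [hS]; rfl) (.seq (hpop _ _ _) (hp _ _ _))
    refine .mono (.loop_step ?_ h1 (exec_drain g S hS hpop hp t (g y x))) ?_
    · rw [hS]; rfl
    · simp only [List.length_cons]; omega

theorem foldl_push (t a : List Bool) : t.foldl (fun x y => y :: x) a = t.reverse ++ a := by
  induction t generalizing a with
  | nil => rfl
  | cons y t ih => simp [ih]

theorem drain_main : Exec (drain fun y => .push main y) (mk i a b t u c)
    (mk i (t.reverse ++ a) b [] u c) (5 * t.length + 1) := by
  rw [← foldl_push]
  exact exec_drain List.cons (fun a t => mk i a b t u c) (fun _ _ => rfl) (fun _ _ _ => pop_tmp₁)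
    (fun _ _ _ => push_main.mono (by omega)) t a

theorem drain_aux : Exec (drain fun y => .push aux y) (mk i a b t u c)
    (mk i a (t.reverse ++ b) [] u c) (5 * t.length + 1) := by
  rw [← foldl_push]
  exact exec_drain List.cons (fun b t => mk i a b t u c) (fun _ _ => rfl) (fun _ _ _ => pop_tmp₁)
    (fun _ _ _ => push_aux.mono (by omega)) t b

theorem drain_tmp₂ : Exec (drain fun y => .push tmp₂ y) (mk i a b t u c)
    (mk i a b [] (t.reverse ++ u) c) (5 * t.length + 1) := by
  rw [← foldl_push]
  exact exec_drain List.cons (fun u t => mk i a b t u c) (fun _ _ => rfl) (fun _ _ _ => pop_tmp₁)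
    (fun _ _ _ => push_tmp₂.mono (by omega)) t u

theorem drain_cnt : Exec (drain fun y => .push cnt y) (mk i a b t u c)
    (mk i a b [] u (t.reverse ++ c)) (5 * t.length + 1) := by
  rw [← foldl_push]
  exact exec_drain List.cons (fun c t => mk i a b t u c) (fun _ _ => rfl) (fun _ _ _ => pop_tmp₁)
    (fun _ _ _ => push_cnt.mono (by omega)) t c

theorem drain_both : Exec (drain fun y => .seq (.push main y) (.push aux y)) (mk i a b t u c)
    (mk i (t.reverse ++ a) (t.reverse ++ b) [] u c) (5 * t.length + 1) := by
  have h := exec_drain (p := fun y => .seq (.push main y) (.push aux y))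
    (fun y (x : List Bool × List Bool) => (y :: x.1, y :: x.2))
    (fun x t => mk i x.1 x.2 t u c) (fun _ _ => rfl) (fun _ _ _ => pop_tmp₁)
    (fun _ _ _ => .seq push_main push_aux) t (a, b)
  have e : ∀ (t a b : List Bool), t.foldl (fun (x : List Bool × List Bool) y =>
      (y :: x.1, y :: x.2)) (a, b) = (t.reverse ++ a, t.reverse ++ b) := by
    intro t
    induction t with
    | nil => intros; rfl
    | cons y t ih => intros; simp [ih]
  rwa [e] at h

/-- Remove everything from `tmp₁`. -/
def clear : Prog := .loop tmp₁ Option.isSome (.pop tmp₁)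

theorem exec_clear : Exec clear (mk i a b t u c) (mk i a b [] u c) (2 * t.length + 1) := by
  induction t with
  | nil => exact .loop_exit rfl
  | cons y t ih =>
    exact (Exec.loop_step rfl pop_tmp₁ ih).mono (by simp only [List.length_cons]; omega)

/-- Move a tree from `main` to `tmp₁`, in reverse. The counter holds the number of trees still
to be read. -/
def readMain : Prog := .seq (.push cnt true) (.loop cnt Option.isSome
  (.ite main isTrue
    (.seq (.pop main) (.seq (.push tmp₁ true) (.push cnt true)))
    (.seq (.pop main) (.seq (.push tmp₁ false) (.pop cnt)))))

/-- Move a tree from `aux` to `tmp₁`, in reverse. -/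
def readAux : Prog := .seq (.push cnt true) (.loop cnt Option.isSome
  (.ite aux isTrue
    (.seq (.pop aux) (.seq (.push tmp₁ true) (.push cnt true)))
    (.seq (.pop aux) (.seq (.push tmp₁ false) (.pop cnt)))))

/-- The loop does not stop at the end of a subtree, so the induction needs an arbitrary continuation
`h`. A node raises the number of trees still to be read by one; its left subtree is read with the
reading of the right one as continuation. -/
theorem exec_readMain_loop : ∀ (x : Bin) {a t c : List Bool} {s : ∀ k, List (Sym k)} {n : ℕ},
    Exec (.loop cnt Option.isSome
      (.ite main isTrue
        (.seq (.pop main) (.seq (.push tmp₁ true) (.push cnt true)))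
        (.seq (.pop main) (.seq (.push tmp₁ false) (.pop cnt)))))
      (mk i a b (x.code.reverse ++ t) u c) s n →
    Exec (.loop cnt Option.isSome
      (.ite main isTrue
        (.seq (.pop main) (.seq (.push tmp₁ true) (.push cnt true)))
        (.seq (.pop main) (.seq (.push tmp₁ false) (.pop cnt)))))
      (mk i (x.code ++ a) b t u (true :: c)) s (n + 5 * x.size)
  | .leaf, a, t, c, s, n, h => by
    refine (Exec.loop_step rfl (.ite_false rfl (.seq pop_main (.seq push_tmp₁ pop_cnt)))
      h).mono ?_
    simp only [Bin.size]; omega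
  | .node l r, a, t, c, s, n, h => by
    have h2 := exec_readMain_loop l (a := r.code ++ a) (c := true :: c) (t := true :: t)
      (exec_readMain_loop r (by simpa [Bin.code] using h))
    rw [← List.append_assoc] at h2
    refine (Exec.loop_step rfl (.ite_true rfl (.seq pop_main (.seq push_tmp₁ push_cnt)))
      h2).mono ?_
    simp only [Bin.size]; omega

theorem exec_readMain (x : Bin) : Exec readMain (mk i (x.code ++ a) b t u [])
    (mk i a b (x.code.reverse ++ t) u []) (5 * x.size + 2) :=
  (Exec.seq push_cnt (exec_readMain_loop x (.loop_exit rfl))).mono (by omega)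

theorem exec_readAux_loop : ∀ (x : Bin) {b t c : List Bool} {s : ∀ k, List (Sym k)} {n : ℕ},
    Exec (.loop cnt Option.isSome
      (.ite aux isTrue
        (.seq (.pop aux) (.seq (.push tmp₁ true) (.push cnt true)))
        (.seq (.pop aux) (.seq (.push tmp₁ false) (.pop cnt)))))
      (mk i a b (x.code.reverse ++ t) u c) s n →
    Exec (.loop cnt Option.isSome
      (.ite aux isTrue
        (.seq (.pop aux) (.seq (.push tmp₁ true) (.push cnt true)))
        (.seq (.pop aux) (.seq (.push tmp₁ false) (.pop cnt)))))
      (mk i a (x.code ++ b) t u (true :: c)) s (n + 5 * x.size)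
  | .leaf, b, t, c, s, n, h => by
    refine (Exec.loop_step rfl (.ite_false rfl (.seq pop_aux (.seq push_tmp₁ pop_cnt)))
      h).mono ?_
    simp only [Bin.size]; omega
  | .node l r, b, t, c, s, n, h => by
    have h2 := exec_readAux_loop l (b := r.code ++ b) (c := true :: c) (t := true :: t)
      (exec_readAux_loop r (by simpa [Bin.code] using h))
    rw [← List.append_assoc] at h2
    refine (Exec.loop_step rfl (.ite_true rfl (.seq pop_aux (.seq push_tmp₁ push_cnt)))
      h2).mono ?_
    simp only [Bin.size]; omega

theorem exec_readAux (x : Bin) : Exec readAux (mk i a (x.code ++ b) t u [])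
    (mk i a b (x.code.reverse ++ t) u []) (5 * x.size + 2) :=
  (Exec.seq push_cnt (exec_readAux_loop x (.loop_exit rfl))).mono (by omega)

/-- Remove a tree from `main`. -/
def drop : Prog := .seq readMain clear

theorem exec_drop (x : Bin) : Exec drop (mk i (x.code ++ a) b [] u [])
    (mk i a b [] u []) (10 * x.size + 10) :=
  (Exec.seq (exec_readMain x) exec_clear).mono (by simp; omega)

/-- Move a tree from `main` to `aux`. -/
def save : Prog := .seq readMain (drain fun y => .push aux y)

theorem exec_save (x : Bin) : Exec save (mk i (x.code ++ a) b [] u [])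
    (mk i a (x.code ++ b) [] u []) (10 * x.size + 10) := by
  have h := Exec.seq (exec_readMain (i := i) (a := a) (b := b) (t := []) (u := u) x) drain_aux
  simp only [List.append_nil, List.reverse_reverse, List.length_reverse, Bin.length_code] at h
  exact h.mono (by omega)

/-- Move a tree from `aux` to `main`. -/
def restore : Prog := .seq readAux (drain fun y => .push main y)

theorem exec_restore (x : Bin) : Exec restore (mk i a (x.code ++ b) [] u [])
    (mk i (x.code ++ a) b [] u []) (10 * x.size + 10) := by
  have h := Exec.seq (exec_readAux (i := i) (a := a) (b := b) (t := []) (u := u) x) drain_main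
  simp only [List.append_nil, List.reverse_reverse, List.length_reverse, Bin.length_code] at h
  exact h.mono (by omega)

/-- Duplicate the tree on top of `main`. -/
def dup : Prog := .seq readMain (.seq (drain fun y => .seq (.push main y) (.push aux y)) restore)

theorem exec_dup (x : Bin) : Exec dup (mk i (x.code ++ a) b [] u [])
    (mk i (x.code ++ (x.code ++ a)) b [] u []) (20 * x.size + 20) := by
  have h := @drain_both i a b (x.code.reverse ++ []) u []
  rw [List.append_nil, List.reverse_reverse, List.length_reverse, Bin.length_code] at h
  have h1 := @exec_readMain i a b [] u x
  rw [List.append_nil] at h1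
  exact (Exec.seq h1 (.seq h (exec_restore x))).mono (by omega)

/-- Compare `tmp₂` with `cnt`, emptying both, and put a mark on `tmp₁` for every difference. -/
def compare : Prog := .seq
  (.loop tmp₂ Option.isSome (.ite tmp₂ isTrue
    (.seq (.pop tmp₂) (.ite cnt isTrue (.pop cnt) (.seq (.pop cnt) (.push tmp₁ true))))
    (.seq (.pop tmp₂) (.ite cnt (fun o => o = some false) (.pop cnt)
      (.seq (.pop cnt) (.push tmp₁ true))))))
  (.loop cnt Option.isSome (.seq (.pop cnt) (.push tmp₁ true)))

/-- Marks are never removed, so none remain exactly if all symbols matched and neither word was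
longer. The second loop marks what is left on `cnt`. -/
theorem exec_compare : ∃ m, m.length ≤ u.length + c.length ∧ (m = [] ↔ u = c) ∧
    Exec compare (mk i a b [] u c) (mk i a b m [] []) (6 * u.length + 3 * c.length + 2) := by
  -- `cnt` may run out before `tmp₂`; popping then leaves it empty.
  have pop_cnt' : ∀ {t u c}, Exec (.pop cnt) (mk i a b t u c) (mk i a b t u c.tail) 1 := by
    intro t u c
    have h := Exec.pop cnt (mk i a b t u c)
    rwa [update_cnt] at h
  have rest : ∀ (c t : List Bool), ∃ m, m.length ≤ t.length + c.length ∧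
      (m = [] ↔ t = [] ∧ c = []) ∧
      Exec (.loop cnt Option.isSome (.seq (.pop cnt) (.push tmp₁ true)))
        (mk i a b t [] c) (mk i a b m [] []) (3 * c.length + 1) := by
    intro c
    induction c with
    | nil => exact fun t => ⟨t, by simp, by simp, .loop_exit rfl⟩
    | cons y c ih =>
      intro t
      obtain ⟨m, hm, he, hx⟩ := ih (true :: t)
      refine ⟨m, ?_, ?_, (Exec.loop_step rfl (.seq pop_cnt push_tmp₁) hx).mono ?_⟩
      · simp only [List.length_cons] at hm ⊢; omega
      · simp [he]
      · simp only [List.length_cons]; omega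
  have first : ∀ (u c t : List Bool), ∃ m c', m.length + c'.length ≤ t.length + u.length + c.length
      ∧ c'.length ≤ c.length ∧ ((m = [] ∧ c' = []) ↔ t = [] ∧ u = c) ∧
      Exec (.loop tmp₂ Option.isSome (.ite tmp₂ isTrue
        (.seq (.pop tmp₂) (.ite cnt isTrue (.pop cnt) (.seq (.pop cnt) (.push tmp₁ true))))
        (.seq (.pop tmp₂) (.ite cnt (fun o => o = some false) (.pop cnt)
          (.seq (.pop cnt) (.push tmp₁ true))))))
        (mk i a b t u c) (mk i a b m [] c') (6 * u.length + 1) := by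
    intro u
    induction u with
    | nil =>
      refine fun c t => ⟨t, c, by simp, le_rfl, ?_, .loop_exit rfl⟩
      rw [eq_comm (a := [])]
    | cons y u ih =>
      intro c t
      by_cases hy : c.head? = some y
      · obtain ⟨m, c', h1, h2, h3, hx⟩ := ih c.tail t
        obtain ⟨c, rfl⟩ : ∃ d, c = y :: d := by
          cases c with
          | nil => simp at hy
          | cons z c => simp at hy; exact ⟨c, by rw [hy]⟩
        simp only [List.tail_cons] at h1 h2 h3 hx
        refine ⟨m, c', ?_, ?_, ?_, ?_⟩
        · simp only [List.length_cons]; omega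
        · simp only [List.length_cons]; omega
        · simp [h3]
        · refine (Exec.loop_step rfl ?_ hx).mono (m := (1 + (1 + 1) + 1) + (6 * u.length + 1) + 1)
            (by simp only [List.length_cons]; omega)
          cases y
          · exact .ite_false rfl (.seq pop_tmp₂ (.ite_true rfl pop_cnt))
          · exact .ite_true rfl (.seq pop_tmp₂ (.ite_true rfl pop_cnt))
      · obtain ⟨m, c', h1, h2, h3, hx⟩ := ih c.tail (true :: t)
        have hl : c.tail.length ≤ c.length := by simp
        refine ⟨m, c', ?_, by omega, ?_, ?_⟩
        · simp only [List.length_cons] at h1 ⊢; omega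
        · rw [h3]
          constructor
          · simp
          · rintro ⟨-, rfl⟩
            simp at hy
        · refine (Exec.loop_step rfl ?_ hx).mono
            (m := (1 + ((1 + 1) + 1) + 1) + (6 * u.length + 1) + 1)
            (by simp only [List.length_cons]; omega)
          cases y
          · refine .ite_false rfl (.seq pop_tmp₂ (.ite_false ?_ (.seq pop_cnt' push_tmp₁)))
            exact decide_eq_false hy
          · refine .ite_true rfl (.seq pop_tmp₂ (.ite_false ?_ (.seq pop_cnt' push_tmp₁)))
            exact decide_eq_false hy
  obtain ⟨m, c', h1, h2, h3, hx⟩ := first u c []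
  obtain ⟨m', h4, h5, hx'⟩ := rest c' m
  simp only [List.length_nil] at h1
  exact ⟨m', by omega, by rw [h5, h3]; simp, (Exec.seq hx hx').mono (by omega)⟩

end Prog

/-! ### Programs that replace one tree by another -/

namespace Prog

/-- Started with the tree `x` on top of `main` and with empty stacks for intermediate results, the
program replaces `x` by `y` within `n` steps. -/
def Computes (p : Prog) (x y : Bin) (n : ℕ) : Prop :=
  ∀ i a b, Exec p (mk i (x.code ++ a) b [] [] []) (mk i (y.code ++ a) b [] [] []) n

variable {p q r : Prog} {x y z w : Bin} {m n k : ℕ}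

theorem Computes.mono (h : Computes p x y m) (hmn : m ≤ n) : Computes p x y n :=
  fun i a b => (h i a b).mono hmn

theorem Computes.seq (h : Computes p x y m) (h' : Computes q y z n) :
    Computes (.seq p q) x z (m + n) :=
  fun i a b => .seq (h i a b) (h' i a b)

/-- Do nothing. -/
def nop : Prog := .seq (.push main true) (.pop main)

theorem exec_nop {i : List PlanSymbol} {a b t u c : List Bool} :
    Exec nop (mk i a b t u c) (mk i a b t u c) 2 :=
  .seq push_main pop_main

/-- Push a word on `main`. -/
def pushWord : List Bool → Prog
  | [] => nop
  | y :: w => .seq (pushWord w) (.push main y)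

theorem exec_pushWord {i : List PlanSymbol} {a b t u c : List Bool} : ∀ w : List Bool,
    Exec (pushWord w) (mk i a b t u c) (mk i (w ++ a) b t u c) (w.length + 2)
  | [] => exec_nop.mono (by simp)
  | y :: w => (Exec.seq (exec_pushWord w) push_main).mono (by simp)

theorem computes_const : Computes (.seq drop (pushWord y.code)) x y (10 * x.size + y.size + 12) :=
  fun _ _ _ => (Exec.seq (exec_drop x) (exec_pushWord y.code)).mono (by simp; omega)

/-- Run two programs on the same tree, and pair the results. -/
def pair (p q : Prog) : Prog :=
  .seq dup (.seq p (.seq save (.seq q (.seq restore (.push main true)))))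

/-- The first result waits on `aux` while `q` consumes the second copy of `x`. A `true` in front of
the two codes then turns them into a node. -/
theorem Computes.pair (h : Computes p x y m) (h' : Computes q x z n) :
    Computes (pair p q) x (.node y z) (m + n + 20 * x.size + 20 * y.size + 41) := by
  intro i a b
  have h1 := Exec.seq (exec_dup (i := i) (a := a) (b := b) x)
    (.seq (h i (x.code ++ a) b) (.seq (exec_save y) (.seq (h' i a (y.code ++ b))
      (.seq (exec_restore y) (push_main (y := true))))))
  simp only [Bin.code, List.cons_append, List.append_assoc]
  exact h1.mono (by omega)

/-- The left subtree. -/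
def fst : Prog := .ite main isTrue (.seq (.pop main) (.seq save (.seq drop restore))) nop

theorem computes_fst : Computes fst (.node x y) x (20 * x.size + 10 * y.size + 35) := by
  intro i a b
  simp only [Bin.code, List.cons_append, List.append_assoc]
  exact (Exec.ite_true rfl (.seq pop_main (.seq (exec_save x) (.seq (exec_drop y)
    (exec_restore x))))).mono (by omega)

theorem computes_fst_leaf : Computes fst .leaf .leaf 3 :=
  fun _ _ _ => .ite_false rfl exec_nop

/-- The right subtree. -/
def snd : Prog := .ite main isTrue (.seq (.pop main) drop) nop

theorem computes_snd : Computes snd (.node x y) y (10 * x.size + 15) := by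
  intro i a b
  simp only [Bin.code, List.cons_append, List.append_assoc]
  exact (Exec.ite_true rfl (.seq pop_main (exec_drop x))).mono (by omega)

theorem computes_snd_leaf : Computes snd .leaf .leaf 3 :=
  fun _ _ _ => .ite_false rfl exec_nop

/-- Branch according to whether the result of `p` is a leaf. -/
def cond (p q r : Prog) : Prog :=
  .seq dup (.seq p (.ite main isTrue (.seq drop q) (.seq drop r)))

theorem Computes.cond_node (h : Computes p x (.node y z) m) (h' : Computes q x w n) :
    Computes (cond p q r) x w (m + n + 20 * x.size + 10 * (y.size + z.size) + 45) := by
  intro i a b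
  have h1 := exec_drop (i := i) (a := x.code ++ a) (b := b) (u := []) (.node y z)
  exact (Exec.seq (exec_dup x) (.seq (h i (x.code ++ a) b) (.ite_true rfl
    (.seq h1 (h' i a b))))).mono (by simp only [Bin.size]; omega)

theorem Computes.cond_leaf (h : Computes p x .leaf m) (h' : Computes r x w n) :
    Computes (cond p q r) x w (m + n + 20 * x.size + 45) := by
  intro i a b
  have h1 := exec_drop (i := i) (a := x.code ++ a) (b := b) (u := []) .leaf
  exact (Exec.seq (exec_dup x) (.seq (h i (x.code ++ a) b) (.ite_false rfl
    (.seq h1 (h' i a b))))).mono (by simp only [Bin.size]; omega)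

/-- Are the two subtrees equal? -/
def eq : Prog :=
  .seq (.pop main) (.seq readMain (.seq (drain fun y => .push tmp₂ y) (.seq readMain
    (.seq (drain fun y => .push cnt y) (.seq compare
      (.ite tmp₁ Option.isSome (.seq clear (pushWord [false]))
        (pushWord [true, false, false])))))))

-- Reading reverses a code and draining reverses it again, so `compare` sees both codes in their
-- original order. By `Bin.code_injective` equality of the codes is equality of the trees.
open Classical in
theorem computes_eq : Computes eq (.node x y)
    (if x = y then .node .leaf .leaf else .leaf) (20 * (x.size + y.size) + 30) := by
  intro i a b
  obtain ⟨d, hd, he, hx⟩ := exec_compare (i := i) (a := a) (b := b) (u := x.code) (c := y.code)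
  have h1 := exec_readMain (i := i) (a := y.code ++ a) (b := b) (t := []) (u := []) x
  have h2 := drain_tmp₂ (i := i) (a := y.code ++ a) (b := b) (t := x.code.reverse) (u := [])
    (c := [])
  have h3 := exec_readMain (i := i) (a := a) (b := b) (t := []) (u := x.code) y
  have h4 := drain_cnt (i := i) (a := a) (b := b) (t := y.code.reverse) (u := x.code) (c := [])
  simp only [List.append_nil, List.reverse_reverse, List.length_reverse, Bin.length_code]
    at h1 h2 h3 h4 hd hx
  have h5 : Exec (.ite tmp₁ Option.isSome (.seq clear (pushWord [false]))
      (pushWord [true, false, false])) (mk i a b d [] [])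
      (mk i ((if x = y then Bin.node .leaf .leaf else .leaf).code ++ a) b [] [] [])
      (2 * (x.size + y.size) + 6) := by
    by_cases h : x = y
    · obtain rfl : d = [] := he.2 (by rw [h])
      rw [if_pos h]
      exact (Exec.ite_false rfl (exec_pushWord [true, false, false])).mono (by simp)
    · rw [if_neg h]
      have hn : d ≠ [] := fun e => h (Bin.code_injective (he.1 e))
      refine (Exec.ite_true ?_ (.seq exec_clear (exec_pushWord [false]))).mono ?_
      · cases d with
        | nil => exact absurd rfl hn
        | cons _ _ => rfl
      · simp only [List.length_cons, List.length_nil]; omega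
  simp only [Bin.code, List.cons_append, List.append_assoc]
  exact (Exec.seq pop_main (.seq h1 (.seq h2 (.seq h3 (.seq h4 (.seq hx h5)))))).mono (by omega)

/-- Fold a program over the list in the left subtree, starting from the right subtree. -/
def fold (p : Prog) : Prog :=
  .seq (.pop main) (.seq save (.seq
    (.loop aux isTrue (.seq (.pop aux) (.seq restore (.seq (.push main true) p)))) (.pop aux)))

end Prog

/-! ### Encodings by trees -/

/-- Types whose elements are encoded by binary trees. -/
class Enc (α : Type) where
  /-- the tree that encodes an element -/
  enc : α → Bin
  enc_injective : Function.Injective enc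

open Enc

instance : Enc Unit := ⟨fun _ => .leaf, fun _ _ _ => rfl⟩

instance : Enc Bool := ⟨fun b => bif b then .node .leaf .leaf else .leaf, by
  intro a b h; cases a <;> cases b <;> first | rfl | nomatch h⟩

instance {α β : Type} [Enc α] [Enc β] : Enc (α × β) := ⟨fun p => .node (enc p.1) (enc p.2), by
  rintro ⟨a, b⟩ ⟨c, d⟩ h
  injection h with h₁ h₂
  exact Prod.ext (enc_injective h₁) (enc_injective h₂)⟩

/-- The tree of a list. -/
def encList {α : Type} [Enc α] : List α → Bin
  | [] => .leaf
  | a :: l => .node (enc a) (encList l)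

theorem encList_injective {α : Type} [Enc α] : Function.Injective (encList (α := α))
  | [], [], _ => rfl
  | [], _ :: _, h => nomatch h
  | _ :: _, [], h => nomatch h
  | a :: l, b :: m, h => by
    injection h with h₁ h₂
    rw [enc_injective h₁, encList_injective h₂]

instance {α : Type} [Enc α] : Enc (List α) := ⟨encList, encList_injective⟩

namespace PlanSymbol

instance : DecidableEq PlanSymbol
  | bit b, bit c => decidable_of_iff (b = c) (by simp)
  | undef, undef => isTrue rfl
  | endValue, endValue => isTrue rfl
  | endBlock, endBlock => isTrue rfl
  | bit _, undef => isFalse (fun h => nomatch h)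
  | bit _, endValue => isFalse (fun h => nomatch h)
  | bit _, endBlock => isFalse (fun h => nomatch h)
  | undef, bit _ => isFalse (fun h => nomatch h)
  | undef, endValue => isFalse (fun h => nomatch h)
  | undef, endBlock => isFalse (fun h => nomatch h)
  | endValue, bit _ => isFalse (fun h => nomatch h)
  | endValue, undef => isFalse (fun h => nomatch h)
  | endValue, endBlock => isFalse (fun h => nomatch h)
  | endBlock, bit _ => isFalse (fun h => nomatch h)
  | endBlock, undef => isFalse (fun h => nomatch h)
  | endBlock, endValue => isFalse (fun h => nomatch h)

instance : Fintype PlanSymbol :=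
  ⟨{bit false, bit true, undef, endValue, endBlock}, fun s => by
    cases s with
    | bit b => cases b <;> simp
    | _ => simp⟩

/-- The tree of a symbol. -/
def toBin : PlanSymbol → Bin
  | bit false => .leaf
  | bit true => .node .leaf .leaf
  | undef => .node (.node .leaf .leaf) .leaf
  | endValue => .node .leaf (.node .leaf .leaf)
  | endBlock => .node (.node .leaf .leaf) (.node .leaf .leaf)

instance : Enc PlanSymbol := ⟨toBin, by
  intro a b h
  rcases a with ⟨_ | _⟩ | _ | _ | _ <;> rcases b with ⟨_ | _⟩ | _ | _ | _ <;>
    simp_all [toBin]⟩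

end PlanSymbol

/-- The size of the tree of an element. -/
def esize {α : Type} [Enc α] (a : α) : ℕ := (enc a).size

section esize

variable {α β : Type} [Enc α] [Enc β]

theorem esize_pos (a : α) : 0 < esize a := Bin.size_pos _

@[simp] theorem esize_pair (a : α) (b : β) : esize (a, b) = esize a + esize b + 1 := rfl

@[simp] theorem esize_nil : esize ([] : List α) = 1 := rfl

@[simp] theorem esize_cons (a : α) (l : List α) : esize (a :: l) = esize a + esize l + 1 := rfl

theorem esize_append (l m : List α) : esize (l ++ m) + 1 = esize l + esize m := by
  induction l with
  | nil => simp; omega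
  | cons a l ih => simp; omega

@[simp] theorem esize_reverse (l : List α) : esize l.reverse = esize l := by
  induction l with
  | nil => rfl
  | cons a l ih => have := esize_append l.reverse [a]; simp at this ⊢; omega

theorem esize_append_le (l m : List α) : esize (l ++ m) ≤ esize l + esize m := by
  have := esize_append l m; omega

theorem length_lt_esize (l : List α) : l.length < esize l := by
  induction l with
  | nil => simp
  | cons a l ih => simp; omega

theorem esize_lt_of_mem {a : α} {l : List α} (h : a ∈ l) : esize a < esize l := by
  induction l with
  | nil => simp at h
  | cons b l ih =>
    rcases List.mem_cons.1 h with rfl | h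
    · simp
    · have := ih h; simp; omega

theorem esize_le_of_forall {l : List α} {B : ℕ} (h : ∀ a ∈ l, esize a ≤ B) :
    esize l ≤ l.length * (B + 1) + 1 := by
  induction l with
  | nil => simp
  | cons b l ih =>
    have h1 := h b (by simp)
    have h2 := ih fun a ha => h a (by simp [ha])
    simp only [esize_cons, List.length_cons, Nat.succ_mul]
    omega

theorem esize_bool_le (b : Bool) : esize b ≤ 3 := by cases b <;> decide

end esize

/-! ### Folds over encoded lists -/

namespace Prog

variable {β σ : Type} [Enc β] [Enc σ]

/-- On `aux` a nonempty list shows `true`, followed by its head and the code of its tail, so each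
turn consumes one entry and leaves a list again. The time bound for `p` is required only at pairs
that really occur: an entry with the fold of its predecessors. -/
theorem exec_fold_loop {p : Prog} {h : σ → β → σ} {n : ℕ} : ∀ (l : List β) (s : σ),
    (∀ l₁ e l₂, l = l₁ ++ e :: l₂ →
      Computes p (enc (e, l₁.foldl h s)) (enc (h (l₁.foldl h s) e)) n) →
    ∀ i a b, Exec (.loop aux isTrue (.seq (.pop aux) (.seq restore (.seq (.push main true) p))))
      (mk i ((enc s).code ++ a) ((enc l).code ++ b) [] [] [])
      (mk i ((enc (l.foldl h s)).code ++ a) (Bin.leaf.code ++ b) [] [] []) (esize l * (n + 30))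
  | [], s, _, i, a, b => by
    refine Exec.mono (.loop_exit rfl) ?_
    simp
  | e :: l, s, H, i, a, b => by
    have h1 := H [] e l rfl i a ((enc l).code ++ b)
    have h2 := exec_fold_loop l (h s e)
      (fun l₁ e' l₂ hl => H (e :: l₁) e' l₂ (by rw [hl]; rfl)) i a b
    have h3 := exec_restore (i := i) (a := (enc s).code ++ a) (b := (enc l).code ++ b) (u := [])
      (enc e)
    have e1 : (enc (e :: l)).code ++ b = true :: ((enc e).code ++ ((enc l).code ++ b)) := by
      change true :: (_ ++ _) ++ _ = _
      simp only [List.cons_append, List.append_assoc]; rfl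
    have e2 : (enc (e, s)).code ++ a = true :: ((enc e).code ++ ((enc s).code ++ a)) := by
      change true :: (_ ++ _) ++ _ = _
      simp only [List.cons_append, List.append_assoc]
    rw [List.foldl_nil, e2] at h1
    rw [e1, List.foldl_cons]
    refine (Exec.loop_step rfl (.seq pop_aux (.seq h3 (.seq push_main h1))) h2).mono ?_
    change 1 + (10 * esize e + 10 + (1 + n)) + esize l * (n + 30) + 1 ≤
      (esize e + esize l + 1) * (n + 30)
    have := esize_pos e
    nlinarith [Nat.zero_le (esize e * n)]

theorem computes_fold {p : Prog} {h : σ → β → σ} {n : ℕ} {l : List β} {s : σ}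
    (H : ∀ l₁ e l₂, l = l₁ ++ e :: l₂ →
      Computes p (enc (e, l₁.foldl h s)) (enc (h (l₁.foldl h s) e)) n) :
    Computes (fold p) (enc (l, s)) (enc (l.foldl h s)) (esize l * (n + 40) + 20) := by
  intro i a b
  have e2 : (enc (l, s)).code ++ a = true :: ((enc l).code ++ ((enc s).code ++ a)) := by
    change true :: (_ ++ _) ++ _ = _
    simp only [List.cons_append, List.append_assoc]
  rw [e2]
  refine (Exec.seq pop_main (.seq (exec_save (enc l)) (.seq (exec_fold_loop l s H i a b)
    pop_aux))).mono ?_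
  change 1 + (10 * esize l + 10 + (esize l * (n + 30) + 1)) ≤ _
  rw [Nat.mul_add, Nat.mul_add]
  omega

end Prog

/-! ### Polynomial time -/

/-- `g` is bounded by a power of `N`. -/
def PolyBdd {α : Type} (N g : α → ℕ) : Prop := ∃ c, ∀ a, g a ≤ N a ^ c

namespace PolyBdd

variable {α β : Type} {N g h : α → ℕ}

theorem mono (hg : PolyBdd N g) (hh : ∀ a, h a ≤ g a) : PolyBdd N h :=
  hg.imp fun _ hc a => (hh a).trans (hc a)

theorem self : PolyBdd N N := ⟨1, fun a => by simp⟩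

/-- Since the base is at least 2, constants and the factor 2 of a sum are absorbed by the exponent;
thus pure powers suffice as bounds. -/
theorem const (hN : ∀ a, 2 ≤ N a) (k : ℕ) : PolyBdd N fun _ => k :=
  ⟨k, fun a => Nat.lt_two_pow_self.le.trans (Nat.pow_le_pow_left (hN a) k)⟩

theorem mul (hg : PolyBdd N g) (hh : PolyBdd N h) : PolyBdd N fun a => g a * h a := by
  obtain ⟨c, hc⟩ := hg
  obtain ⟨d, hd⟩ := hh
  exact ⟨c + d, fun a => by rw [pow_add]; exact Nat.mul_le_mul (hc a) (hd a)⟩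

theorem add (hN : ∀ a, 2 ≤ N a) (hg : PolyBdd N g) (hh : PolyBdd N h) :
    PolyBdd N fun a => g a + h a := by
  obtain ⟨c, hc⟩ := hg
  obtain ⟨d, hd⟩ := hh
  refine ⟨max c d + 1, fun a => ?_⟩
  have h0 : 0 < N a := by have := hN a; omega
  have h1 := (hc a).trans (Nat.pow_le_pow_right h0 (le_max_left c d))
  have h2 := (hd a).trans (Nat.pow_le_pow_right h0 (le_max_right c d))
  rw [pow_succ]
  have := hN a
  nlinarith

theorem comp {M k : β → ℕ} {F : α → β} (hk : PolyBdd M k) (hM : PolyBdd N fun a => M (F a)) :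
    PolyBdd N fun a => k (F a) := by
  obtain ⟨c, hc⟩ := hk
  obtain ⟨d, hd⟩ := hM
  exact ⟨d * c, fun a => (hc (F a)).trans (by
    rw [pow_mul]; exact Nat.pow_le_pow_left (hd a) c)⟩

end PolyBdd

/-- The measure by which running times are bounded: the size of the tree plus an allowance. -/
def meas {α : Type} [Enc α] (μ : α → ℕ) (a : α) : ℕ := esize a + μ a + 2

theorem two_le_meas {α : Type} [Enc α] (μ : α → ℕ) (a : α) : 2 ≤ meas μ a := by
  unfold meas; omega

/-- Some program computes `F` in time polynomial in the size of the argument and in `μ`. -/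
def FTime {α β : Type} [Enc α] [Enc β] (μ : α → ℕ) (F : α → β) : Prop :=
  ∃ (p : Prog) (t : α → ℕ), PolyBdd (meas μ) t ∧ PolyBdd (meas μ) (fun a => esize (F a)) ∧
    ∀ a, p.Computes (enc a) (enc (F a)) (t a)

/-- Some program computes `F` in polynomial time. -/
abbrev PTime {α β : Type} [Enc α] [Enc β] (F : α → β) : Prop := FTime (fun _ => 0) F

/-! ### Closure properties of computability within an allowance -/

namespace FTime

open Prog

variable {α β γ δ σ : Type} [Enc α] [Enc β] [Enc γ] [Enc δ] [Enc σ] {μ : α → ℕ}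

theorem esize_bdd {F : α → β} (h : FTime μ F) : PolyBdd (meas μ) (fun a => esize (F a)) := by
  obtain ⟨p, t, _, h, _⟩ := h
  exact h

theorem bdd_id : PolyBdd (meas μ) (esize (α := α)) :=
  PolyBdd.self.mono fun a => by unfold meas; omega

/-- Mere changes of type cost nothing; a pair of an entry and a list, for instance, is the same tree
as the longer list. -/
theorem of_enc_eq {F : α → β} (h : ∀ a, enc (F a) = enc a) : FTime μ F :=
  ⟨nop, fun _ => 2, .const (two_le_meas μ) 2,
    bdd_id.mono fun a => by rw [esize, h]; rfl, fun a i x y => by rw [h]; exact exec_nop⟩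

protected theorem id : FTime μ fun a : α => a := of_enc_eq fun _ => rfl

theorem congr {F G : α → β} (h : FTime μ F) (e : ∀ a, G a = F a) : FTime μ G := by
  rwa [show G = F from funext e]

/-- The allowance belongs to the argument `a`, so `G` has to be polynomial in its own argument
alone. The size bound contained in `hF` converts this into a bound in terms of `a`. -/
theorem comp {G : β → γ} {F : α → β} (hG : PTime G) (hF : FTime μ F) :
    FTime μ fun a => G (F a) := by
  obtain ⟨p, t, ht, hs, hp⟩ := hG
  obtain ⟨q, t', ht', hs', hq⟩ := hF
  have hm : PolyBdd (meas μ) fun a => meas (fun _ => 0) (F a) :=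
    (hs'.add (two_le_meas μ) (.const (two_le_meas μ) 2)).mono fun a => by simp [meas]
  exact ⟨.seq q p, fun a => t' a + t (F a), ht'.add (two_le_meas μ) (ht.comp hm),
    hs.comp hm, fun a => (hq a).seq (hp (F a))⟩

theorem const (b : β) : FTime μ fun _ : α => b := by
  refine ⟨.seq drop (pushWord (enc b).code), fun a => 10 * esize a + ((enc b).size + 12), ?_,
    .const (two_le_meas μ) _, fun a => computes_const⟩
  exact ((PolyBdd.const (two_le_meas μ) 10).mul bdd_id).add (two_le_meas μ)
    (.const (two_le_meas μ) _)

theorem pair {F : α → β} {G : α → γ} (hF : FTime μ F) (hG : FTime μ G) :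
    FTime μ fun a => (F a, G a) := by
  obtain ⟨p, t, ht, hs, hp⟩ := hF
  obtain ⟨q, t', ht', hs', hq⟩ := hG
  have h2 := two_le_meas μ
  refine ⟨Prog.pair p q, fun a => t a + t' a + 20 * esize a + 20 * esize (F a) + 41, ?_, ?_,
    fun a => (hp a).pair (hq a)⟩
  · exact (((ht.add h2 ht').add h2 ((PolyBdd.const h2 20).mul bdd_id)).add h2
      ((PolyBdd.const h2 20).mul hs)).add h2 (.const h2 _)
  · exact (hs.add h2 hs').add h2 (.const h2 1)

theorem fst' : PTime (Prod.fst : α × β → α) := by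
  have h2 := two_le_meas (fun _ : α × β => 0)
  refine ⟨Prog.fst, fun x => 20 * esize x + 35, ?_, ?_, ?_⟩
  · exact ((PolyBdd.const h2 20).mul bdd_id).add h2 (.const h2 _)
  · exact bdd_id.mono fun a => by
      rw [show esize a = esize a.1 + esize a.2 + 1 from rfl]; omega
  · rintro ⟨a, b⟩
    exact computes_fst.mono (by
      change 20 * esize a + 10 * esize b + 35 ≤ 20 * (esize a + esize b + 1) + 35
      omega)

theorem snd' : PTime (Prod.snd : α × β → β) := by
  have h2 := two_le_meas (fun _ : α × β => 0)
  refine ⟨Prog.snd, fun x => 20 * esize x + 35, ?_, ?_, ?_⟩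
  · exact ((PolyBdd.const h2 20).mul bdd_id).add h2 (.const h2 _)
  · exact bdd_id.mono fun a => by
      rw [show esize a = esize a.1 + esize a.2 + 1 from rfl]; omega
  · rintro ⟨a, b⟩
    exact computes_snd.mono (by
      change 10 * esize a + 15 ≤ 20 * (esize a + esize b + 1) + 35
      omega)

theorem fst {F : α → β × γ} (h : FTime μ F) : FTime μ fun a => (F a).1 := fst'.comp h

theorem snd {F : α → β × γ} (h : FTime μ F) : FTime μ fun a => (F a).2 := snd'.comp h

theorem cons {F : α → β} {G : α → List β} (hF : FTime μ F) (hG : FTime μ G) :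
    FTime μ fun a => F a :: G a :=
  comp (G := fun p : β × List β => p.1 :: p.2) (of_enc_eq fun _ => rfl) (hF.pair hG)

theorem tail {F : α → List β} (h : FTime μ F) : FTime μ fun a => (F a).tail := by
  refine comp (G := List.tail) ?_ h
  have h2 := two_le_meas (fun _ : List β => 0)
  refine ⟨Prog.snd, fun x => 20 * esize x + 35, ?_, ?_, ?_⟩
  · exact ((PolyBdd.const h2 20).mul bdd_id).add h2 (.const h2 _)
  · exact bdd_id.mono fun a => by cases a <;> simp; omega
  · rintro (_ | ⟨a, l⟩)
    · exact computes_snd_leaf.mono (by dsimp only; omega)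
    · exact computes_snd.mono (by
        change 10 * esize a + 15 ≤ 20 * (esize a + esize l + 1) + 35
        omega)

/-- The head of a list of lists, or the empty list. -/
theorem headI {F : α → List (List β)} (h : FTime μ F) : FTime μ fun a => (F a).headI := by
  refine comp (G := List.headI) ?_ h
  have h2 := two_le_meas (fun _ : List (List β) => 0)
  refine ⟨Prog.fst, fun x => 20 * esize x + 35, ?_, ?_, ?_⟩
  · exact ((PolyBdd.const h2 20).mul bdd_id).add h2 (.const h2 _)
  · exact bdd_id.mono fun a => by
      cases a
      · exact le_rfl
      · simp; omega
  · rintro (_ | ⟨a, l⟩)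
    · exact computes_fst_leaf.mono (by dsimp only; omega)
    · exact computes_fst.mono (by
        change 20 * esize a + 10 * esize l + 35 ≤ 20 * (esize a + esize l + 1) + 35
        omega)

/-- `false` and the empty list are both encoded by a leaf, so one test serves truth values and
lists. -/
theorem cond_leaf {C : α → β} {F G : α → γ} (hC : FTime μ C) (hF : FTime μ F) (hG : FTime μ G)
    (P : α → Prop) [DecidablePred P] (hP : ∀ a, P a ↔ enc (C a) ≠ .leaf) :
    FTime μ fun a => if P a then F a else G a := by
  obtain ⟨p, t, ht, hs, hp⟩ := hC
  obtain ⟨q, t', ht', hs', hq⟩ := hF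
  obtain ⟨r, t'', ht'', hs'', hr⟩ := hG
  have h2 := two_le_meas μ
  refine ⟨Prog.cond p q r, fun a => t a + (t' a + t'' a) + 20 * esize a + 10 * esize (C a) + 45,
    ?_, ?_, fun a => ?_⟩
  · exact (((ht.add h2 (ht'.add h2 ht'')).add h2 ((PolyBdd.const h2 20).mul bdd_id)).add h2
      ((PolyBdd.const h2 10).mul hs)).add h2 (.const h2 _)
  · refine (hs'.add h2 hs'').mono fun a => ?_
    dsimp only
    split_ifs <;> omega
  · have h1 := hp a
    have e : esize (C a) = (enc (C a)).size := rfl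
    dsimp only
    rw [e]
    split_ifs with h
    · obtain ⟨y, z, hyz⟩ : ∃ y z, enc (C a) = .node y z := by
        cases hc : enc (C a) with
        | leaf => exact absurd hc ((hP a).1 h)
        | node y z => exact ⟨y, z, rfl⟩
      rw [hyz] at h1 ⊢
      exact (h1.cond_node (hq a)).mono (by simp only [Bin.size, esize]; omega)
    · have hc : enc (C a) = .leaf := by by_contra hc; exact h ((hP a).2 hc)
      rw [hc] at h1 ⊢
      exact (h1.cond_leaf (hr a)).mono (by simp only [esize]; omega)

theorem ite {C : α → Bool} {F G : α → γ} (hC : FTime μ C) (hF : FTime μ F) (hG : FTime μ G) :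
    FTime μ fun a => if C a then F a else G a :=
  hC.cond_leaf hF hG _ fun a => by cases C a <;> simp [enc]

theorem isEmpty {F : α → List β} (h : FTime μ F) : FTime μ fun a => (F a).isEmpty := by
  refine (h.cond_leaf (const false) (const true) (fun a => F a ≠ []) fun a => ?_).congr fun a => ?_
  · cases F a <;> simp [enc, encList]
  · cases F a <;> simp

theorem decEq [DecidableEq β] {F G : α → β} (hF : FTime μ F) (hG : FTime μ G) :
    FTime μ fun a => decide (F a = G a) := by
  refine comp (G := fun p : β × β => decide (p.1 = p.2)) ?_ (hF.pair hG)
  have h2 := two_le_meas (fun _ : β × β => 0)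
  refine ⟨Prog.eq, fun x => 20 * esize x + 30, ?_, (PolyBdd.const h2 3).mono fun a =>
    esize_bool_le _, ?_⟩
  · exact ((PolyBdd.const h2 20).mul bdd_id).add h2 (.const h2 _)
  · rintro ⟨a, b⟩
    have h := computes_eq (x := enc a) (y := enc b)
    rw [enc_injective.eq_iff] at h
    have e : enc (decide (a = b)) = if a = b then Bin.node .leaf .leaf else .leaf := by
      split_ifs with hab
      · rw [decide_eq_true hab]; rfl
      · rw [decide_eq_false hab]; rfl
    dsimp only
    rw [e]
    convert h.mono ?_
    · rfl
    change 20 * (esize a + esize b) + 30 ≤ 20 * (esize a + esize b + 1) + 30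
    omega

theorem and {F G : α → Bool} (hF : FTime μ F) (hG : FTime μ G) : FTime μ fun a => F a && G a :=
  (hF.ite hG (const false)).congr fun a => by cases F a <;> rfl

theorem or {F G : α → Bool} (hF : FTime μ F) (hG : FTime μ G) : FTime μ fun a => F a || G a :=
  (hF.ite (const true) hG).congr fun a => by cases F a <;> rfl

theorem not {F : α → Bool} (hF : FTime μ F) : FTime μ fun a => !F a :=
  (hF.ite (const false) (const true)).congr fun a => by cases F a <;> rfl

/-- A left fold takes polynomial time if its intermediate results have polynomial size. -/
theorem foldl {l : α → List β} {g : α → σ} {h : α → σ → β → σ} (hl : FTime μ l) (hg : FTime μ g)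
    (hh : PTime fun p : α × β × σ => h p.1 p.2.2 p.2.1) {B : α → ℕ} (hB : PolyBdd (meas μ) B)
    (bound : ∀ a l₁ l₂, l a = l₁ ++ l₂ → esize (l₁.foldl (h a) (g a)) ≤ B a) :
    FTime μ fun a => (l a).foldl (h a) (g a) := by
  have h2 := two_le_meas μ
  -- The program for folds passes only an entry and a state to its body; hence the argument `a`
  -- travels as part of the state.
  have hH : PTime fun p : β × α × σ => (p.2.1, h p.2.1 p.2.2 p.1) :=
    FTime.pair (FTime.id.snd.fst) (hh.comp (F := fun p : β × α × σ => (p.2.1, p.1, p.2.2))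
      (FTime.id.snd.fst.pair (FTime.id.fst.pair FTime.id.snd.snd)))
  obtain ⟨p, t, ⟨c, hc⟩, -, hp⟩ := hH
  obtain ⟨q, t', ht', hs', hq⟩ := hl.pair (FTime.id.pair hg)
  have hsize : PolyBdd (meas μ) fun a => esize (l a) := hl.esize_bdd
  -- The 4 is the two nodes of the triple `(b, a, s)` and the 2 in `meas`.
  let T : α → ℕ := fun a => (esize (l a) + esize a + B a + 4) ^ c
  have hT : PolyBdd (meas μ) T :=
    PolyBdd.comp (M := fun a => esize (l a) + esize a + B a + 4) (F := fun a => a)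
      ⟨c, fun _ => le_rfl⟩ (((hsize.add h2 bdd_id).add h2 hB).add h2 (.const h2 4))
  have hfold : FTime μ fun a => (a, (l a).foldl (h a) (g a)) := by
    refine ⟨.seq q (fold p), fun a => t' a + (esize (l a) * (T a + 40) + 20), ?_, ?_, fun a => ?_⟩
    · exact ht'.add h2 ((hsize.mul (hT.add h2 (.const h2 40))).add h2 (.const h2 20))
    · refine ((bdd_id.add h2 hB).add h2 (.const h2 1)).mono fun a => ?_
      have := bound a (l a) [] (by simp)
      simp only [esize_pair]; omega
    · refine (hq a).seq ?_
      have e : ∀ (m : List β) (s : σ), m.foldl (fun (x : α × σ) b => (x.1, h x.1 x.2 b)) (a, s) =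
          (a, m.foldl (h a) s) := by
        intro m
        induction m with
        | nil => intro s; rfl
        | cons b m ih => intro s; exact ih _
      dsimp only
      rw [← e]
      refine computes_fold (h := fun (x : α × σ) b => (x.1, h x.1 x.2 b)) fun l₁ b l₂ hl' => ?_
      rw [e]
      refine (hp (b, a, l₁.foldl (h a) (g a))).mono ((hc _).trans (Nat.pow_le_pow_left ?_ c))
      have h3 := bound a l₁ (b :: l₂) hl'
      have h4 : esize b < esize (l a) := esize_lt_of_mem (by rw [hl']; simp)
      simp only [meas, esize_pair]
      omega
  exact hfold.snd

end FTime

/-! ### Polynomial time functions on lists -/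

/-- Pairs of the entries of two lists, where the second list is extended by empty lists. -/
def zipD {β γ : Type} : List β → List (List γ) → List (β × List γ)
  | [], _ => []
  | b :: l, m => (b, m.headI) :: zipD l m.tail

/-- All lists that result from a list by the insertion of `b`. -/
def insertions {β : Type} (b : β) : List β → List (List β)
  | [] => [[b]]
  | a :: l => (b :: a :: l) :: (insertions b l).map (a :: ·)

theorem length_insertions {β : Type} (b : β) (l : List β) :
    (insertions b l).length = l.length + 1 := by
  induction l with
  | nil => rfl
  | cons a l ih => simp [insertions, ih]

section

variable {β γ : Type} [Enc β] [Enc γ]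

theorem esize_headI_tail (m : List (List γ)) : esize m.headI + esize m.tail ≤ esize m + 1 := by
  cases m
  · exact le_rfl
  · simp; omega

theorem esize_zipD (l : List β) (m : List (List γ)) :
    esize (zipD l m) ≤ 3 * esize l + esize m := by
  induction l generalizing m with
  | nil => simp [zipD]; omega
  | cons b l ih =>
    have h1 := ih m.tail
    have h2 := esize_headI_tail m
    have h3 := esize_pos b
    simp only [zipD, esize_cons, esize_pair]
    omega

theorem esize_of_mem_insertions {b : β} {l m : List β} (h : m ∈ insertions b l) :
    esize m = esize b + esize l + 1 := by
  induction l generalizing m with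
  | nil => simp [insertions] at h; subst h; simp
  | cons a l ih =>
    simp only [insertions, List.mem_cons, List.mem_map] at h
    rcases h with rfl | ⟨m, hm, rfl⟩
    · simp
    · simp [ih hm]; omega

theorem esize_insertions (b : β) (l : List β) :
    esize (insertions b l) ≤ (esize l + 1) * (esize b + esize l + 2) + 1 := by
  refine (esize_le_of_forall fun m hm => (esize_of_mem_insertions hm).le).trans ?_
  rw [length_insertions]
  have := length_lt_esize l
  gcongr

end

namespace FTime

variable {α β γ σ : Type} [Enc α] [Enc β] [Enc γ] [Enc σ] {μ : α → ℕ}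

theorem reverse {l : α → List β} (hl : FTime μ l) : FTime μ fun a => (l a).reverse := by
  refine (hl.foldl (g := fun _ => []) (h := fun _ s b => b :: s) (const [])
    (FTime.id.snd.fst.cons FTime.id.snd.snd) hl.esize_bdd fun a l₁ l₂ h => ?_).congr fun a => ?_
  · have h1 := esize_append l₁ l₂
    have h2 := esize_pos l₂
    rw [List.foldl_flip_cons_eq_append, List.append_nil, List.map_id', esize_reverse, h]
    omega
  · simp

/-- A right fold takes polynomial time if its intermediate results have polynomial size. -/
theorem foldr {l : α → List β} {g : α → σ} {h : α → β → σ → σ} (hl : FTime μ l) (hg : FTime μ g)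
    (hh : PTime fun p : α × β × σ => h p.1 p.2.1 p.2.2) {B : α → ℕ} (hB : PolyBdd (meas μ) B)
    (bound : ∀ a l₁ l₂, l a = l₁ ++ l₂ → esize (l₂.foldr (h a) (g a)) ≤ B a) :
    FTime μ fun a => (l a).foldr (h a) (g a) := by
  refine (hl.reverse.foldl (h := fun a s b => h a b s) hg hh hB fun a l₁ l₂ e => ?_).congr
    fun a => ?_
  · have h1 := bound a l₂.reverse l₁.reverse (by
      rw [← List.reverse_append, ← e, List.reverse_reverse])
    rwa [List.foldr_reverse] at h1
  · rw [List.foldl_reverse]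

theorem append {F G : α → List β} (hF : FTime μ F) (hG : FTime μ G) :
    FTime μ fun a => F a ++ G a := by
  have e : ∀ l m : List β, l.foldr (fun b s => b :: s) m = l ++ m := by simp
  refine (hF.foldr (h := fun _ b s => b :: s) hG (FTime.id.snd.fst.cons FTime.id.snd.snd)
    (hF.esize_bdd.add (two_le_meas μ) hG.esize_bdd) fun a l₁ l₂ h => ?_).congr fun a => (e _ _).symm
  have h1 := esize_append l₁ l₂
  have h2 := esize_append_le l₂ (G a)
  have h3 := esize_pos l₁
  rw [e, h]
  omega

theorem map {l : α → List β} {f : α → β → γ} (hl : FTime μ l)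
    (hf : PTime fun p : α × β => f p.1 p.2) : FTime μ fun a => (l a).map (f a) := by
  have e : ∀ a (l : List β), l.foldr (fun b s => f a b :: s) [] = l.map (f a) := by
    intro a l
    induction l with
    | nil => rfl
    | cons b l ih => simp [ih]
  obtain ⟨c, hc⟩ := hf.esize_bdd
  have h2 := two_le_meas μ
  -- The 3 is the node of the pair `(a, b)` and the 2 in `meas`.
  have hT : PolyBdd (meas μ) fun a => (esize a + esize (l a) + 3) ^ c :=
    PolyBdd.comp (M := fun a => esize a + esize (l a) + 3) (F := fun a => a)
      ⟨c, fun _ => le_rfl⟩ ((bdd_id.add h2 hl.esize_bdd).add h2 (.const h2 3))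
  refine (hl.foldr (h := fun a b s => f a b :: s) (const [])
    (.cons (hf.comp (FTime.id.fst.pair FTime.id.snd.fst)) FTime.id.snd.snd)
    ((hl.esize_bdd.mul (hT.add h2 (.const h2 1))).add h2 (.const h2 1))
    fun a l₁ l₂ h => ?_).congr fun a => (e _ _).symm
  rw [e]
  refine (esize_le_of_forall (B := (esize a + esize (l a) + 3) ^ c) fun x hx => ?_).trans ?_
  · obtain ⟨b, hb, rfl⟩ := List.mem_map.1 hx
    refine (hc (a, b)).trans (Nat.pow_le_pow_left ?_ c)
    have : esize b < esize (l a) := esize_lt_of_mem (by rw [h]; simp [hb])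
    simp only [meas, esize_pair]
    omega
  · have h3 : l₂.length ≤ esize (l a) := by
      have := length_lt_esize (l a)
      have : (l a).length = l₁.length + l₂.length := by rw [h, List.length_append]
      omega
    rw [List.length_map]
    gcongr

theorem flatten {l : α → List (List β)} (hl : FTime μ l) : FTime μ fun a => (l a).flatten := by
  have e : ∀ l : List (List β), l.foldr (fun b s => b ++ s) [] = l.flatten := by
    intro l
    induction l with
    | nil => rfl
    | cons b l ih => simp [ih]
  have e2 : ∀ l : List (List β), esize l.flatten ≤ esize l := by
    intro l
    induction l with
    | nil => simp
    | cons b l ih => have := esize_append_le b l.flatten; simp; omega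
  refine (hl.foldr (h := fun _ b s => b ++ s) (const [])
    (FTime.id.snd.fst.append FTime.id.snd.snd) hl.esize_bdd
    fun a l₁ l₂ h => ?_).congr fun a => (e _).symm
  have h1 := e2 l₂
  have h3 := esize_append l₁ l₂
  have h4 := esize_pos l₁
  rw [e, h]
  omega

theorem flatMap {l : α → List β} {f : α → β → List γ} (hl : FTime μ l)
    (hf : PTime fun p : α × β => f p.1 p.2) : FTime μ fun a => (l a).flatMap (f a) :=
  (hl.map hf).flatten

theorem any {l : α → List β} {f : α → β → Bool} (hl : FTime μ l)
    (hf : PTime fun p : α × β => f p.1 p.2) : FTime μ fun a => (l a).any (f a) := by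
  refine (hl.foldr (g := fun _ => false) (h := fun a b s => f a b || s) (const false)
    (.or (hf.comp (FTime.id.fst.pair FTime.id.snd.fst)) FTime.id.snd.snd)
    (.const (two_le_meas μ) 3) fun a l₁ l₂ h => esize_bool_le _).congr fun a => ?_
  induction l a with
  | nil => rfl
  | cons b l ih => simp [ih]

/-- The first entry with some property, as a list of length at most one. -/
theorem first {l : α → List β} {f : α → β → Bool} (hl : FTime μ l)
    (hf : PTime fun p : α × β => f p.1 p.2) : FTime μ fun a => ((l a).filter (f a)).take 1 := by
  have e : ∀ a (l : List β), l.foldr (fun b s => if f a b then [b] else s) [] =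
      (l.filter (f a)).take 1 := by
    intro a l
    induction l with
    | nil => rfl
    | cons b l ih => by_cases h : f a b <;> simp [h, ih]
  refine (hl.foldr (h := fun a b s => if f a b then [b] else s) (const [])
    (.ite (hf.comp (FTime.id.fst.pair FTime.id.snd.fst)) (FTime.id.snd.fst.cons (const []))
      FTime.id.snd.snd)
    (hl.esize_bdd.add (two_le_meas μ) (.const (two_le_meas μ) 2)) fun a l₁ l₂ h => ?_).congr
    fun a => (e _ _).symm
  rw [e]
  rcases hm : l₂.filter (f a) with _ | ⟨b, m⟩
  · simp
  · have hb : b ∈ l₂.filter (f a) := by rw [hm]; simp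
    have : esize b < esize (l a) := esize_lt_of_mem (by
      rw [h]; simp [(List.mem_filter.1 hb).1])
    simp; omega

theorem zipD {l : α → List β} {m : α → List (List γ)} (hl : FTime μ l) (hm : FTime μ m) :
    FTime μ fun a => _root_.zipD (l a) (m a) := by
  have h2 := two_le_meas μ
  -- The state of the fold is the unread rest of the second list and the reversed output.
  have e : ∀ (l : List β) (m : List (List γ)) (o : List (β × List γ)),
      l.foldl (fun (s : List (List γ) × List (β × List γ)) b => (s.1.tail, (b, s.1.headI) :: s.2))
        (m, o) = ((List.tail^[l.length]) m, (_root_.zipD l m).reverse ++ o) := by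
    intro l
    induction l with
    | nil => intros; rfl
    | cons b l ih => intro m o; simp [ih, _root_.zipD]
  have et : ∀ n (m : List (List γ)), esize ((List.tail^[n]) m) ≤ esize m := by
    intro n
    induction n with
    | zero => intro m; rfl
    | succ n ih =>
      intro m
      have h1 := ih m.tail
      have h2 := esize_headI_tail m
      have h3 := esize_pos m.headI
      rw [Function.iterate_succ_apply]
      omega
  have h := hl.foldl (g := fun a => (m a, ([] : List (β × List γ))))
    (h := fun _ s b => (s.1.tail, (b, s.1.headI) :: s.2)) (hm.pair (const []))
    (FTime.id.snd.snd.fst.tail.pair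
      ((FTime.id.snd.fst.pair FTime.id.snd.snd.fst.headI).cons FTime.id.snd.snd.snd))
    (B := fun a => 3 * esize (l a) + 2 * esize (m a) + 1)
    ((((PolyBdd.const h2 3).mul hl.esize_bdd).add h2
      ((PolyBdd.const h2 2).mul hm.esize_bdd)).add h2 (.const h2 1)) fun a l₁ l₂ h => by
      rw [e, List.append_nil, esize_pair, esize_reverse]
      have h1 := et l₁.length (m a)
      have h2 := esize_zipD l₁ (m a)
      have h3 := esize_append l₁ l₂
      have h4 := esize_pos l₂
      rw [h]
      omega
  refine h.snd.reverse.congr fun a => ?_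
  rw [e]
  simp

theorem insertions {b : α → β} {l : α → List β} (hb : FTime μ b) (hl : FTime μ l) :
    FTime μ fun a => _root_.insertions (b a) (l a) := by
  refine comp (G := fun p : β × List β => _root_.insertions p.1 p.2) ?_ (hb.pair hl)
  have h2 := two_le_meas fun _ : β × List β => 0
  -- The list itself is rebuilt alongside its insertions, because each step puts `b` in front of the
  -- whole list.
  have e : ∀ (b : β) (l : List β), l.foldr (fun a (s : List β × List (List β)) =>
      (a :: s.1, (b :: a :: s.1) :: s.2.map (a :: ·))) ([], [[b]]) =
      (l, _root_.insertions b l) := by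
    intro b l
    induction l with
    | nil => rfl
    | cons a l ih => simp [ih, _root_.insertions]
  have hstep : PTime fun p : (β × List β) × β × (List β × List (List β)) =>
      (p.2.1 :: p.2.2.1, (p.1.1 :: p.2.1 :: p.2.2.1) :: p.2.2.2.map (p.2.1 :: ·)) :=
    (FTime.id.snd.fst.cons FTime.id.snd.snd.fst).pair
      ((FTime.id.fst.fst.cons (FTime.id.snd.fst.cons FTime.id.snd.snd.fst)).cons
        (FTime.id.snd.snd.snd.map (FTime.id.fst.snd.fst.cons FTime.id.snd)))
  have h := (FTime.id.snd (α := β × List β) (μ := fun _ => 0)).foldr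
    (h := fun p a (s : List β × List (List β)) =>
      (a :: s.1, (p.1 :: a :: s.1) :: s.2.map (a :: ·)))
    (g := fun p => ([], [[p.1]]))
    ((const []).pair ((FTime.id.fst.cons (const [])).cons (const []))) hstep
    (B := fun p => esize p + ((esize p + 1) * (esize p + esize p + 2) + 1) + 1)
    (((bdd_id.add h2 ((((bdd_id.add h2 (.const h2 1)).mul
      ((bdd_id.add h2 bdd_id).add h2 (.const h2 2)))).add h2 (.const h2 1))).add h2
        (.const h2 1))) fun p l₁ l₂ h => by
      rw [e, esize_pair]
      have h3 : esize l₂ ≤ esize p := by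
        have h4 := esize_append l₁ l₂
        have h5 := esize_pos l₁
        rw [← h] at h4
        have : esize p = esize p.1 + esize p.2 + 1 := rfl
        omega
      have h4 : esize p.1 ≤ esize p := by
        have : esize p = esize p.1 + esize p.2 + 1 := rfl
        omega
      have h5 := esize_insertions p.1 l₂
      have h6 : (esize l₂ + 1) * (esize p.1 + esize l₂ + 2) + 1 ≤
        (esize p + 1) * (esize p + esize p + 2) + 1 := by gcongr
      omega
  exact h.snd.congr fun p => by rw [e]

end FTime

/-! ### The planning algorithm

The algorithm works on words: a value is a word of symbols, a partial state is the list of the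
values of all variables, an action is the pair of its precondition and its effect. -/

namespace PlanSearch

open PlanSymbol

/-- Words for values and the undefined value. -/
abbrev Tok := List PlanSymbol

/-- Words for partial states. -/
abbrev Block := List Tok

/-- Words for actions. -/
abbrev Act := Block × Block

/-- The part of the condition `c` that the state `s` violates. -/
def need (c s : Block) : Block :=
  (zipD c s).map fun p => if decide (p.1 = [undef]) || decide (p.1 = p.2) then [undef] else p.1

/-- The state after an action with effect `e`. -/
def applyEff (e s : Block) : Block :=
  (zipD e s).map fun p => if decide (p.1 = [undef]) then p.2 else p.1

/-- Does the effect `e` achieve some of the values in `d`? -/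
def meets (d e : Block) : Bool :=
  (zipD e d).any fun p => decide (p.1 = p.2) && !decide (p.1 = [undef])

/-- Is the partial state completely undefined? -/
def allUndef (b : Block) : Bool := !b.any fun t => !decide (t = [undef])

/-- Run one action; the second component records the first violated condition. -/
def run (st : Block × Block) (a : Act) : Block × Block :=
  if allUndef st.2 then (applyEff a.2 st.1, need a.1 st.1) else st

/-- The first condition in an action sequence that is violated, or a completely undefined partial
state if the sequence is a plan. -/
def flaw (init goal : Block) (S : List Act) : Block :=
  if allUndef (S.foldl run (init, [])).2 then need goal (S.foldl run (init, [])).1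
  else (S.foldl run (init, [])).2

/-- All sequences that arise from `S` by the insertion of an action that achieves a value that is
missing at the first violated condition. -/
def expand (init goal : Block) (acts S : List Act) : List (List Act) :=
  ((acts.filter fun b => meets (flaw init goal S) b.2).take 1).flatMap fun b => insertions b S

/-- Replace the sequences in a list by their expansions, and record whether there was a plan. -/
def level (init goal : Block) (acts : List Act) (st : List (List Act) × Bool) :
    List (List Act) × Bool :=
  (st.1.flatMap (expand init goal acts), st.2 || st.1.any fun S => allUndef (flaw init goal S))

/-- Add a symbol in front of a parsed word. -/
def parseStep (s : PlanSymbol) (l : List Block) : List Block :=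
  if decide (s = endBlock) then [] :: l
  else if decide (s = endValue) then ([] :: l.headI) :: l.tail
  else ((s :: l.headI.headI) :: l.headI.tail) :: l.tail

/-- Split a word into blocks. -/
def parse (w : List PlanSymbol) : List Block := w.foldr parseStep []

/-- Convert a number from binary to unary. -/
def unary (t : Tok) : List Unit :=
  t.foldr (fun b u => if decide (b = bit true) then () :: (u ++ u) else u ++ u) []

/-- Join consecutive blocks to actions. -/
def pairUp (l : List Block) : List Act :=
  (l.foldr (fun b (s : List Block × List Act) =>
    if s.1.isEmpty then ([b], s.2) else ([], (b, s.1.headI) :: s.2)) ([], [])).2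

/-- The initial state in a parsed word. -/
def initOf (l : List Block) : Block := l.tail.tail.headI

/-- The goal in a parsed word. -/
def goalOf (l : List Block) : Block := l.tail.tail.tail.headI

/-- The actions in a parsed word. -/
def actsOf (l : List Block) : List Act := pairUp l.tail.tail.tail.tail

/-- The levels of the search. -/
def levels (l : List Block) (u : List Unit) : List (List Act) × Bool :=
  u.foldl (fun st _ => level (initOf l) (goalOf l) (actsOf l) st) ([[]], false)

/-- The decision procedure: search `k + 1` levels. -/
def decideWord (w : List PlanSymbol) : Bool :=
  (levels (parse w) (() :: unary (parse w).headI.headI)).2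

end PlanSearch

/-! ### Running time of the planning algorithm -/

namespace FTime

open PlanSearch PlanSymbol

variable {α : Type} [Enc α] {μ : α → ℕ}

theorem need {c s : α → Block} (hc : FTime μ c) (hs : FTime μ s) :
    FTime μ fun a => PlanSearch.need (c a) (s a) :=
  have h : PTime fun q : α × Tok × Tok =>
      if decide (q.2.1 = [undef]) || decide (q.2.1 = q.2.2) then [undef] else q.2.1 :=
    .ite (.or (.decEq FTime.id.snd.fst (const _)) (.decEq FTime.id.snd.fst FTime.id.snd.snd))
      (const _) FTime.id.snd.fst
  (hc.zipD hs).map (f := fun _ _ => _) h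

theorem applyEff {c s : α → Block} (hc : FTime μ c) (hs : FTime μ s) :
    FTime μ fun a => PlanSearch.applyEff (c a) (s a) :=
  have h : PTime fun q : α × Tok × Tok => if decide (q.2.1 = [undef]) then q.2.2 else q.2.1 :=
    .ite (.decEq FTime.id.snd.fst (const _)) FTime.id.snd.snd FTime.id.snd.fst
  (hc.zipD hs).map (f := fun _ _ => _) h

theorem meets {c s : α → Block} (hc : FTime μ c) (hs : FTime μ s) :
    FTime μ fun a => PlanSearch.meets (c a) (s a) :=
  have h : PTime fun q : α × Tok × Tok => decide (q.2.1 = q.2.2) && !decide (q.2.1 = [undef]) :=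
    .and (.decEq FTime.id.snd.fst FTime.id.snd.snd) (.not (.decEq FTime.id.snd.fst (const _)))
  (hs.zipD hc).any (f := fun _ _ => _) h

theorem allUndef {b : α → Block} (hb : FTime μ b) : FTime μ fun a => PlanSearch.allUndef (b a) :=
  .not (hb.any (f := fun _ t => !decide (t = [undef])) (.not (.decEq FTime.id.snd (const _))))

theorem esize_applyEff (e s : Block) : esize (PlanSearch.applyEff e s) ≤ esize e + esize s := by
  induction e generalizing s with
  | nil => simp [PlanSearch.applyEff, _root_.zipD]
  | cons t e ih =>
    have h1 := ih s.tail
    have h2 := esize_headI_tail s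
    have h3 := esize_pos t
    have h4 := esize_pos s.headI
    simp only [PlanSearch.applyEff, _root_.zipD, List.map_cons, esize_cons] at h1 ⊢
    split_ifs <;> omega

theorem esize_undef : esize [undef] = 7 := rfl

/-- An entry may be replaced by `[undef]`, whose tree has size 7. -/
theorem esize_need (c s : Block) : esize (PlanSearch.need c s) ≤ 7 * esize c := by
  induction c generalizing s with
  | nil => simp [PlanSearch.need, _root_.zipD]
  | cons t c ih =>
    have h1 := ih s.tail
    have h3 := esize_pos t
    have h4 := esize_undef
    simp only [PlanSearch.need, _root_.zipD, List.map_cons, esize_cons] at h1 ⊢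
    split_ifs <;> omega

/-- An effect adds at most its own size to the state, and the recorded condition is overwritten
rather than extended. So the growth is linear in the sequence. -/
theorem esize_run (S : List Act) (st : Block × Block) :
    esize (S.foldl run st) ≤ esize st + 8 * esize S := by
  induction S generalizing st with
  | nil => simp
  | cons a S ih =>
    have h1 := ih (run st a)
    have h2 : esize (run st a) ≤ esize st + 8 * esize a := by
      unfold run
      have e1 : esize st = esize st.1 + esize st.2 + 1 := rfl
      have e2 : esize a = esize a.1 + esize a.2 + 1 := rfl
      have h3 := esize_applyEff a.2 st.1
      have h4 := esize_need a.1 st.1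
      split_ifs
      · rw [esize_pair]; omega
      · omega
    simp only [List.foldl_cons, esize_cons]
    omega

theorem flaw {i g : α → Block} {S : α → List Act} (hi : FTime μ i) (hg : FTime μ g)
    (hS : FTime μ S) : FTime μ fun a => PlanSearch.flaw (i a) (g a) (S a) := by
  have h2 := two_le_meas μ
  have hrun : PTime fun p : α × Act × (Block × Block) => run p.2.2 p.2.1 :=
    .ite (.allUndef FTime.id.snd.snd.snd)
      ((FTime.id.snd.fst.snd.applyEff FTime.id.snd.snd.fst).pair
        (FTime.id.snd.fst.fst.need FTime.id.snd.snd.fst)) FTime.id.snd.snd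
  have h : FTime μ fun a => (S a).foldl run (i a, []) :=
    hS.foldl (h := fun _ => run) (hi.pair (const [])) hrun
      (B := fun a => esize (i a) + 8 * esize (S a) + 2)
      ((hi.esize_bdd.add h2 ((PolyBdd.const h2 8).mul hS.esize_bdd)).add h2 (.const h2 2))
      fun a l₁ l₂ h => by
        have h1 := esize_run l₁ (i a, [])
        have h3 := esize_append l₁ l₂
        have h4 := esize_pos l₂
        rw [← h] at h3
        simp only [esize_pair, esize_nil] at h1
        omega
  exact .ite (.allUndef h.snd) (hg.need h.fst) h.snd

theorem expand {i g : α → Block} {A S : α → List Act} (hi : FTime μ i) (hg : FTime μ g)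
    (hA : FTime μ A) (hS : FTime μ S) :
    FTime μ fun a => PlanSearch.expand (i a) (g a) (A a) (S a) := by
  have hm : PTime fun q : (((Block × Block) × List Act) × List Act) × Act =>
      PlanSearch.meets (PlanSearch.flaw q.1.1.1.1 q.1.1.1.2 q.1.2) q.2.2 :=
    .meets (.flaw FTime.id.fst.fst.fst.fst FTime.id.fst.fst.fst.snd FTime.id.fst.snd)
      FTime.id.snd.snd
  have hf : PTime fun p : ((Block × Block) × List Act) × List Act => (p.1.2.filter fun b =>
      PlanSearch.meets (PlanSearch.flaw p.1.1.1 p.1.1.2 p.2) b.2).take 1 :=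
    FTime.id.fst.snd.first (f := fun _ _ => _) hm
  have hi' : PTime fun q : (((Block × Block) × List Act) × List Act) × Act =>
      _root_.insertions q.2 q.1.2 := .insertions FTime.id.snd FTime.id.fst.snd
  have h : PTime fun p : ((Block × Block) × List Act) × List Act =>
      PlanSearch.expand p.1.1.1 p.1.1.2 p.1.2 p.2 := hf.flatMap (f := fun _ _ => _) hi'
  exact h.comp (((hi.pair hg).pair hA).pair hS)

theorem flatMap_any {κ β γ : Type} [Enc κ] [Enc β] [Enc γ] {e : κ → β → List γ}
    {f : κ → β → Bool} (he : PTime fun p : κ × β => e p.1 p.2)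
    (hf : PTime fun p : κ × β => f p.1 p.2) :
    PTime fun p : κ × (List β × Bool) => (p.2.1.flatMap (e p.1), p.2.2 || p.2.1.any (f p.1)) := by
  have h1 : PTime fun q : (κ × (List β × Bool)) × β => e q.1.1 q.2 :=
    he.comp (FTime.id.fst.fst.pair FTime.id.snd)
  have h2 : PTime fun q : (κ × (List β × Bool)) × β => f q.1.1 q.2 :=
    hf.comp (FTime.id.fst.fst.pair FTime.id.snd)
  exact (FTime.id.snd.fst.flatMap (f := fun _ _ => _) h1).pair
    (.or FTime.id.snd.snd (FTime.id.snd.fst.any (f := fun _ _ => _) h2))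

theorem level {i g : α → Block} {A : α → List Act} {st : α → List (List Act) × Bool}
    (hi : FTime μ i) (hg : FTime μ g) (hA : FTime μ A) (hst : FTime μ st) :
    FTime μ fun a => PlanSearch.level (i a) (g a) (A a) (st a) := by
  have h1 : PTime fun p : ((Block × Block) × List Act) × List Act =>
      PlanSearch.expand p.1.1.1 p.1.1.2 p.1.2 p.2 :=
    .expand FTime.id.fst.fst.fst FTime.id.fst.fst.snd FTime.id.fst.snd FTime.id.snd
  have h2 : PTime fun p : ((Block × Block) × List Act) × List Act =>
      PlanSearch.allUndef (PlanSearch.flaw p.1.1.1 p.1.1.2 p.2) :=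
    .allUndef (.flaw FTime.id.fst.fst.fst FTime.id.fst.fst.snd FTime.id.snd)
  have h := flatMap_any
    (e := fun (c : (Block × Block) × List Act) S => PlanSearch.expand c.1.1 c.1.2 c.2 S)
    (f := fun c S => PlanSearch.allUndef (PlanSearch.flaw c.1.1 c.1.2 S)) h1 h2
  exact h.comp (F := fun a => (((i a, g a), A a), st a)) (((hi.pair hg).pair hA).pair hst)

theorem parse {w : α → List PlanSymbol} (hw : FTime μ w) :
    FTime μ fun a => PlanSearch.parse (w a) := by
  have h2 := two_le_meas μ
  have hstep : PTime fun p : α × PlanSymbol × List Block => parseStep p.2.1 p.2.2 :=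
    .ite (.decEq FTime.id.snd.fst (const _)) ((const []).cons FTime.id.snd.snd)
      (.ite (.decEq FTime.id.snd.fst (const _))
        (.cons ((const []).cons FTime.id.snd.snd.headI) FTime.id.snd.snd.tail)
        (.cons (.cons (FTime.id.snd.fst.cons FTime.id.snd.snd.headI.headI)
          FTime.id.snd.snd.headI.tail) FTime.id.snd.snd.tail))
  have bound : ∀ w, esize (PlanSearch.parse w) ≤ 10 * esize w := by
    intro w
    induction w with
    | nil => simp [PlanSearch.parse]
    | cons s w ih =>
      have h3 := esize_headI_tail (PlanSearch.parse w)
      have h4 := esize_headI_tail (PlanSearch.parse w).headI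
      have h5 := esize_pos s
      change esize (parseStep s (PlanSearch.parse w)) ≤ _
      unfold parseStep
      split_ifs <;> simp only [esize_cons, esize_nil] <;> omega
  refine hw.foldr (h := fun _ => parseStep) (g := fun _ => []) (const []) hstep
    (B := fun a => 10 * esize (w a)) ((PolyBdd.const h2 10).mul hw.esize_bdd) fun a l₁ l₂ h => ?_
  have h3 := bound l₂
  have h4 := esize_append l₁ l₂
  have h5 := esize_pos l₁
  rw [← h] at h4
  unfold PlanSearch.parse at h3
  omega

theorem pairUp {l : α → List Block} (hl : FTime μ l) :
    FTime μ fun a => PlanSearch.pairUp (l a) := by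
  have h2 := two_le_meas μ
  have hstep : PTime fun p : α × Block × (List Block × List Act) =>
      if p.2.2.1.isEmpty then ([p.2.1], p.2.2.2)
      else (([] : List Block), (p.2.1, p.2.2.1.headI) :: p.2.2.2) :=
    .ite FTime.id.snd.snd.fst.isEmpty
      ((FTime.id.snd.fst.cons (const [])).pair FTime.id.snd.snd.snd)
      ((const []).pair ((FTime.id.snd.fst.pair FTime.id.snd.snd.fst.headI).cons
        FTime.id.snd.snd.snd))
  have bound : ∀ l : List Block, esize (l.foldr (fun b (s : List Block × List Act) =>
      if s.1.isEmpty then ([b], s.2) else ([], (b, s.1.headI) :: s.2)) ([], [])) ≤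
      10 * esize l := by
    intro l
    induction l with
    | nil => simp
    | cons b l ih =>
      simp only [List.foldr_cons, esize_cons]
      generalize List.foldr _ _ l = s at ih ⊢
      have h3 := esize_headI_tail s.1
      have h5 := esize_pos b
      have h6 : esize s = esize s.1 + esize s.2 + 1 := rfl
      have h7 := esize_pos s.1.tail
      split_ifs <;> simp only [esize_pair, esize_cons, esize_nil] <;> omega
  exact FTime.snd (hl.foldr (h := fun _ b (s : List Block × List Act) =>
    if s.1.isEmpty then ([b], s.2) else ([], (b, s.1.headI) :: s.2))
    ((const []).pair (const [])) hstep
    (B := fun a => 10 * esize (l a)) ((PolyBdd.const h2 10).mul hl.esize_bdd) fun a l₁ l₂ h => by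
      have h3 := bound l₂
      have h4 := esize_append l₁ l₂
      have h5 := esize_pos l₁
      rw [← h] at h4
      omega)

theorem esize_unit (u : List Unit) : esize u = 2 * u.length + 1 := by
  induction u with
  | nil => rfl
  | cons x u ih => simp [ih, show esize x = 1 from rfl]; omega

/-- Repeated doubling can be exponential in the length of the word, so a bound on the final number
is assumed. Intermediate results belong to suffixes and are no longer than the final one. -/
theorem unary {t : α → Tok} (ht : FTime μ t)
    (hB : PolyBdd (meas μ) fun a => (PlanSearch.unary (t a)).length) :
    FTime μ fun a => PlanSearch.unary (t a) := by
  have h2 := two_le_meas μ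
  have hstep : PTime fun p : α × PlanSymbol × List Unit =>
      if decide (p.2.1 = bit true) then () :: (p.2.2 ++ p.2.2) else p.2.2 ++ p.2.2 :=
    .ite (.decEq FTime.id.snd.fst (const _))
      ((const ()).cons (FTime.id.snd.snd.append FTime.id.snd.snd))
      (FTime.id.snd.snd.append FTime.id.snd.snd)
  have mono : ∀ l₁ l₂ : Tok, (PlanSearch.unary l₂).length ≤
      (PlanSearch.unary (l₁ ++ l₂)).length := by
    intro l₁ l₂
    induction l₁ with
    | nil => exact le_rfl
    | cons b l ih =>
      simp only [PlanSearch.unary, List.cons_append, List.foldr_cons] at ih ⊢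
      split_ifs <;> simp only [List.length_cons, List.length_append] <;> omega
  refine ht.foldr (h := fun _ b u => if decide (b = bit true) then () :: (u ++ u) else u ++ u)
    (g := fun _ => []) (const []) hstep
    (B := fun a => 2 * (PlanSearch.unary (t a)).length + 1)
    (((PolyBdd.const h2 2).mul hB).add h2 (.const h2 1)) fun a l₁ l₂ h => ?_
  have h3 := mono l₁ l₂
  rw [← h] at h3
  rw [esize_unit]
  unfold PlanSearch.unary at h3 ⊢
  omega

/-- The decision procedure takes polynomial time if `k` and the sizes of all levels are
polynomially bounded. -/
theorem decideWord {w : α → List PlanSymbol} (hw : PTime w)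
    (hk : PolyBdd (meas μ) fun a =>
      (PlanSearch.unary (PlanSearch.parse (w a)).headI.headI).length)
    {B : α → ℕ} (hB : PolyBdd (meas μ) B)
    (bound : ∀ a u, u.length ≤ (PlanSearch.unary (PlanSearch.parse (w a)).headI.headI).length + 1 →
      esize (levels (PlanSearch.parse (w a)) u) ≤ B a) :
    FTime μ fun a => PlanSearch.decideWord (w a) := by
  -- Each turn parses the word anew from the argument. The step must be polynomial without
  -- allowance, which is why `hw` is a `PTime` statement.
  have h : PTime fun p : α × Unit × (List (List Act) × Bool) => PlanSearch.parse (w p.1) :=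
    .parse (hw.comp FTime.id.fst)
  have hstep : PTime fun p : α × Unit × (List (List Act) × Bool) =>
      PlanSearch.level (initOf (PlanSearch.parse (w p.1))) (goalOf (PlanSearch.parse (w p.1)))
        (actsOf (PlanSearch.parse (w p.1))) p.2.2 :=
    .level h.tail.tail.headI h.tail.tail.tail.headI (.pairUp h.tail.tail.tail.tail)
      FTime.id.snd.snd
  have hu : FTime μ fun a => () :: PlanSearch.unary (PlanSearch.parse (w a)).headI.headI :=
    (const ()).cons (.unary (FTime.parse (hw.comp FTime.id)).headI.headI hk)
  exact FTime.snd (hu.foldl (h := fun a st _ => PlanSearch.level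
    (initOf (PlanSearch.parse (w a))) (goalOf (PlanSearch.parse (w a)))
        (actsOf (PlanSearch.parse (w a))) st) (const ([[]], false)) hstep hB
    fun a l₁ l₂ hl => bound a l₁ (by
      have := congrArg List.length hl
      simp only [List.length_cons, List.length_append] at this
      omega))

end FTime

/-! ### Insertions and plans -/

theorem mem_insertions {β : Type} {b : β} {l m : List β} :
    m ∈ insertions b l ↔ ∃ l₁ l₂, l = l₁ ++ l₂ ∧ m = l₁ ++ b :: l₂ := by
  induction l generalizing m with
  | nil => simp [insertions]
  | cons a l ih =>
    simp only [insertions, List.mem_cons, List.mem_map, ih]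
    constructor
    · rintro (rfl | ⟨_, ⟨l₁, l₂, rfl, rfl⟩, rfl⟩)
      · exact ⟨[], a :: l, rfl, rfl⟩
      · exact ⟨a :: l₁, l₂, rfl, rfl⟩
    · rintro ⟨_ | ⟨c, l₁⟩, l₂, h, rfl⟩
      · exact Or.inl (by simp only [List.nil_append] at h ⊢; rw [h])
      · simp only [List.cons_append, List.cons.injEq] at h
        exact Or.inr ⟨_, ⟨l₁, l₂, h.2, rfl⟩, by rw [h.1]; rfl⟩

theorem insertions_map {β γ : Type} (f : β → γ) (b : β) (l : List β) :
    insertions (f b) (l.map f) = (insertions b l).map (List.map f) := by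
  induction l with
  | nil => rfl
  | cons a l ih => simp [insertions, ih, Function.comp_def]

namespace SASPlus

variable (I : SASPlus)

/-- Partial states. -/
abbrev PState : Type := Fin I.numVars → Option (Fin I.domSize)

/-- The state after a sequence of actions, whose preconditions are ignored. -/
def resultOf (s : I.State) (p : List (Fin I.numActs)) : I.State :=
  p.foldl (fun s a => I.result a s) s

/-- The part of a condition that a state violates. -/
def need (c : I.PState) (s : I.State) : I.PState :=
  fun v => if c v = some (s v) then none else c v

/-- The first violated condition of a sequence of actions from `s` to the goal. -/
def flaw : I.State → List (Fin I.numActs) → I.PState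
  | s, [] => I.need I.goal s
  | s, a :: p => if I.need (I.pre a) s = (fun _ => none) then flaw (I.result a s) p
      else I.need (I.pre a) s

variable {I}

theorem need_eq_none {c : I.PState} {s : I.State} :
    I.need c s = (fun _ => none) ↔ ∀ v, c v = some (s v) ∨ c v = none := by
  rw [funext_iff]
  refine forall_congr' fun v => ?_
  unfold need
  split_ifs with h
  · simp [h]
  · simp [h]

theorem need_eq_some {c : I.PState} {s : I.State} {v x} (h : I.need c s v = some x) :
    c v = some x ∧ s v ≠ x := by
  unfold need at h
  split_ifs at h with h'
  exact ⟨h, fun e => h' (by rw [h, e])⟩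

theorem flaw_eq_none_iff {s : I.State} {p : List (Fin I.numActs)} :
    I.flaw s p = (fun _ => none) ↔ ∃ t, I.IsGoalState t ∧ I.IsPlanFromTo s p t := by
  induction p generalizing s with
  | nil => simp [flaw, need_eq_none, IsPlanFromTo, IsGoalState]
  | cons a p ih =>
    unfold flaw
    split_ifs with h
    · rw [ih]
      have := need_eq_none.1 h
      simp only [IsPlanFromTo]
      exact exists_congr fun t => and_congr_right fun _ => (and_iff_right this).symm
    · refine iff_of_false h ?_
      rintro ⟨t, -, h1, -⟩
      exact h (need_eq_none.2 h1)

theorem isPlan_iff {p : List (Fin I.numActs)} : I.IsPlan p ↔ I.flaw I.init p = fun _ => none :=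
  flaw_eq_none_iff.symm

/-- If a subsequence misses a value that the whole sequence achieves, then some action that
achieves the value can be inserted into the subsequence. -/
theorem exists_insert {s : I.State} {v : Fin I.numVars} {x : Fin I.domSize}
    (S p : List (Fin I.numActs)) (hS : S.Sublist p) (hne : I.resultOf s S v ≠ x)
    (he : I.resultOf s p v = x) :
    ∃ b S', I.eff b v = some x ∧ S' ∈ insertions b S ∧ S'.Sublist p := by
  induction p using List.reverseRecOn generalizing S with
  | nil => rw [List.sublist_nil.1 hS] at hne; exact absurd he hne
  | append_singleton p c ih =>
    have step : ∀ q, I.resultOf s (q ++ [c]) v = (I.eff c v).getD (I.resultOf s q v) := by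
      intro q; simp [resultOf, result]
    rw [step] at he
    obtain ⟨S₁, S₂, rfl, h1, h2⟩ := List.sublist_append_iff.1 hS
    have h3 : S₂ = [] ∨ S₂ = [c] := by
      rcases S₂ with _ | ⟨d, S₂⟩
      · exact Or.inl rfl
      · have h4 := h2.length_le
        have : S₂ = [] := List.eq_nil_of_length_eq_zero
          (Nat.le_zero.1 (Nat.le_of_succ_le_succ h4))
        subst this
        exact Or.inr (by simpa using h2)
    rcases h3 with rfl | rfl
    -- `S` does not use this last `c`. If `c` affects `v`, it sets it to `x` and can be appended to
    -- `S`; otherwise it is irrelevant to `v` and the induction applies.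
    · rw [List.append_nil] at hne ⊢
      rcases hc : I.eff c v with _ | y
      · rw [hc] at he
        obtain ⟨b, S', hb, hS', hp⟩ := ih S₁ h1 hne he
        exact ⟨b, S', hb, hS', hp.trans (List.sublist_append_left _ _)⟩
      · rw [hc] at he
        exact ⟨c, S₁ ++ [c], by rw [hc]; exact congrArg some he,
          mem_insertions.2 ⟨S₁, [], by simp, rfl⟩,
          h1.append (List.Sublist.refl _)⟩
    -- Both sequences end with `c`, so `c` cannot affect `v`: the final values would agree. The
    -- insertion takes place before it.
    · rw [step] at hne
      rcases hc : I.eff c v with _ | y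
      · rw [hc] at he hne
        obtain ⟨b, S', hb, hS', hp⟩ := ih S₁ h1 hne he
        obtain ⟨l₁, l₂, rfl, rfl⟩ := mem_insertions.1 hS'
        exact ⟨b, _, hb, mem_insertions.2 ⟨l₁, l₂ ++ [c], by simp, rfl⟩,
          by simpa using hp.append (List.Sublist.refl [c])⟩
      · rw [hc] at he hne
        exact absurd he hne

/-- The violated condition is evaluated in the state reached by a prefix of `S`, which can be
compared with the state reached by a matching prefix of a plan. -/
theorem flaw_eq_need (s : I.State) (S : List (Fin I.numActs)) {v : Fin I.numVars}
    {x : Fin I.domSize} (h : I.flaw s S v = some x) :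
    I.flaw s S = I.need I.goal (I.resultOf s S) ∨
      ∃ S₁ a S₂, S = S₁ ++ a :: S₂ ∧ I.flaw s S = I.need (I.pre a) (I.resultOf s S₁) := by
  induction S generalizing s with
  | nil => exact Or.inl rfl
  | cons a S ih =>
    unfold flaw at h ⊢
    split_ifs at h ⊢ with h'
    · rcases ih _ h with h1 | ⟨S₁, b, S₂, rfl, h1⟩
      · exact Or.inl h1
      · exact Or.inr ⟨a :: S₁, b, S₂, rfl, h1⟩
    · exact Or.inr ⟨[], a, S, rfl, rfl⟩

theorem isPlanFromTo_append {s t : I.State} {p q : List (Fin I.numActs)} :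
    I.IsPlanFromTo s (p ++ q) t ↔ I.IsPlanFromTo s p (I.resultOf s p) ∧
      I.IsPlanFromTo (I.resultOf s p) q t := by
  induction p generalizing s with
  | nil => simp [IsPlanFromTo, resultOf]
  | cons a p ih =>
    simp only [List.cons_append, IsPlanFromTo, ih, and_assoc]
    rfl

theorem IsPlanFromTo.eq_resultOf {s t : I.State} {p : List (Fin I.numActs)}
    (h : I.IsPlanFromTo s p t) : t = I.resultOf s p := by
  induction p generalizing s with
  | nil => exact h.symm
  | cons a p ih => exact ih h.2

/-- If a sequence of actions is a subsequence of a plan, then for every value missing at its first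
violated condition the unique action that achieves it can be inserted. -/
theorem RestrictionP.exists_insert (hP : I.RestrictionP) {S p : List (Fin I.numActs)}
    (hS : S.Sublist p) (hp : I.IsPlan p) {v : Fin I.numVars} {x : Fin I.domSize}
    (h : I.flaw I.init S v = some x) :
    ∃ b, I.eff b v = some x ∧ ∀ b', I.eff b' v = some x →
      ∃ S' ∈ insertions b' S, S'.Sublist p := by
  obtain ⟨t, ht, hpt⟩ := hp
  -- Restriction P enters here: any achiever `b'` of the value coincides with the action found by
  -- comparison with `p`.
  suffices H : ∃ b S', I.eff b v = some x ∧ S' ∈ insertions b S ∧ S'.Sublist p by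
    obtain ⟨b, S', hb, h1, h2⟩ := H
    exact ⟨b, hb, fun b' hb' => ⟨S', by rwa [hP v x b' b hb' hb], h2⟩⟩
  rcases flaw_eq_need I.init S h with h1 | ⟨S₁, a, S₂, rfl, h1⟩
  · rw [h1] at h
    obtain ⟨hg, hne⟩ := need_eq_some h
    refine SASPlus.exists_insert S p hS hne ?_
    rw [← hpt.eq_resultOf]
    rcases ht v with h2 | h2
    · rw [hg] at h2; exact (Option.some_injective _ h2).symm
    · rw [hg] at h2; cases h2
  · rw [h1] at h
    obtain ⟨hg, hne⟩ := need_eq_some h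
    -- The embedding of `S` in `p` provides an occurrence of `a` in `p` with `S₁` before it and `S₂`
    -- after it. There `a` is valid, so `v` has the value `x` after `p₁ ++ r₁`; the insertion into
    -- `S₁` is then glued to the rest.
    obtain ⟨p₁, p₂, rfl, hs1, hs2⟩ := List.append_sublist_iff.1 hS
    obtain ⟨q₁, q₂, rfl, ha, hs3⟩ := List.cons_sublist_iff.1 hs2
    obtain ⟨r₁, r₂, rfl⟩ := List.append_of_mem ha
    have e : p₁ ++ (r₁ ++ a :: r₂ ++ q₂) = (p₁ ++ r₁) ++ (a :: (r₂ ++ q₂)) := by simp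
    rw [e] at hpt
    have hv := (isPlanFromTo_append.1 hpt).2.1 v
    have hx : I.resultOf I.init (p₁ ++ r₁) v = x := by
      rcases hv with h2 | h2
      · rw [hg] at h2; exact (Option.some_injective _ h2).symm
      · rw [hg] at h2; cases h2
    obtain ⟨b, S', hb, hS', hsub⟩ := SASPlus.exists_insert S₁ (p₁ ++ r₁)
      (hs1.trans (List.sublist_append_left _ _)) hne hx
    obtain ⟨l₁, l₂, rfl, rfl⟩ := mem_insertions.1 hS'
    refine ⟨b, _, hb, mem_insertions.2 ⟨l₁, l₂ ++ a :: S₂, by simp, rfl⟩, ?_⟩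
    rw [e]
    have := hsub.append ((hs3.trans (List.sublist_append_right r₂ q₂)).cons_cons a)
    simpa using this

end SASPlus

/-! ### The algorithm on the words of an instance -/

namespace PlanSearch

open PlanSymbol

/-- The word of a value. -/
def tokOf : Option ℕ → Tok
  | none => [undef]
  | some m => natCode m

theorem tokOf_eq_undef {o : Option ℕ} : tokOf o = [undef] ↔ o = none := by
  cases o with
  | none => simp [tokOf]
  | some m =>
    simp only [tokOf, reduceCtorEq, iff_false]
    intro h
    exact undef_notMem_natCode m (by rw [h]; simp)

/-- This lets the algorithm compare words in place of values. -/
theorem tokOf_injective : Function.Injective tokOf := by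
  intro o o' h
  cases o with
  | none => exact (tokOf_eq_undef.1 h.symm).symm
  | some m =>
    cases o' with
    | none => exact tokOf_eq_undef.1 h
    | some m' => rw [natCode_injective h]

/-- The word of a partial state. -/
def blk {n d : ℕ} (s : Fin n → Option (Fin d)) : Block :=
  List.ofFn fun v => tokOf ((s v).map Fin.val)

theorem tokOf_map_inj {d : ℕ} {o o' : Option (Fin d)} :
    tokOf (o.map Fin.val) = tokOf (o'.map Fin.val) ↔ o = o' :=
  (tokOf_injective.comp (Option.map_injective Fin.val_injective)).eq_iff

theorem tokOf_map_eq_undef {d : ℕ} {o : Option (Fin d)} :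
    tokOf (o.map Fin.val) = [undef] ↔ o = none := by
  rw [tokOf_eq_undef, Option.map_eq_none_iff]

theorem zipD_ofFn {β γ : Type} {n : ℕ} (f : Fin n → β) (g : Fin n → List γ) :
    zipD (List.ofFn f) (List.ofFn g) = List.ofFn fun i => (f i, g i) := by
  induction n with
  | zero => rfl
  | succ n ih => simp [List.ofFn_succ, zipD, ih]

theorem allUndef_blk {n d : ℕ} {s : Fin n → Option (Fin d)} :
    allUndef (blk s) = true ↔ s = fun _ => none := by
  simp only [allUndef, blk, Bool.not_eq_true', List.any_eq_false, List.forall_mem_ofFn_iff,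
    tokOf_map_eq_undef, funext_iff]
  simp

theorem meets_blk {n d : ℕ} {s e : Fin n → Option (Fin d)} :
    meets (blk s) (blk e) = true ↔ ∃ v x, s v = some x ∧ e v = some x := by
  simp only [meets, blk, zipD_ofFn, List.any_eq_true, List.mem_ofFn, exists_exists_eq_and,
    tokOf_map_inj, tokOf_map_eq_undef, Bool.and_eq_true, decide_eq_true_eq, Bool.not_eq_true',
    decide_eq_false_iff_not]
  refine exists_congr fun v => ⟨fun ⟨h1, h2⟩ => ?_, fun ⟨x, h1, h2⟩ => ?_⟩
  · obtain ⟨x, hx⟩ := Option.ne_none_iff_exists'.1 h2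
    exact ⟨x, by rw [← h1, hx], hx⟩
  · rw [h1, h2]
    exact ⟨rfl, by simp⟩

/-! ### Agreement of the word algorithm with the search on action sequences -/

section

variable {I : SASPlus}

theorem need_blk (c : I.PState) (s : I.State) :
    need (blk c) (blk fun v => some (s v)) = blk (I.need c s) := by
  simp only [need, blk, zipD_ofFn, List.map_ofFn]
  congr 1
  funext v
  simp only [Function.comp_apply, Bool.or_eq_true, decide_eq_true_eq, tokOf_map_inj,
    tokOf_map_eq_undef, SASPlus.need]
  split_ifs with h1 h2 h2
  · rfl
  · rw [h1.resolve_right h2]; rfl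
  · exact absurd (Or.inr h2) h1
  · rfl

theorem applyEff_blk (a : Fin I.numActs) (s : I.State) :
    applyEff (blk (I.eff a)) (blk fun v => some (s v)) = blk fun v => some (I.result a s v) := by
  simp only [applyEff, blk, zipD_ofFn, List.map_ofFn]
  congr 1
  funext v
  simp only [Function.comp_apply, decide_eq_true_eq, tokOf_map_eq_undef, SASPlus.result]
  rcases I.eff a v with _ | x <;> simp

variable (I)

/-- The words of an action. -/
def actOf (a : Fin I.numActs) : Act := (blk (I.pre a), blk (I.eff a))

/-- The words of the initial state. -/
def initBlk : Block := blk fun v => some (I.init v)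

variable {I}

/-- Once a violated condition is recorded, all later actions are ignored; thus the fold returns the
first one. -/
theorem foldl_run_of_ne {st : Block × Block} (h : ¬ allUndef st.2 = true) (S : List Act) :
    S.foldl run st = st := by
  induction S with
  | nil => rfl
  | cons a S ih => rw [List.foldl_cons, run, if_neg h, ih]

theorem flaw_blk (S : List (Fin I.numActs)) :
    flaw (initBlk I) (blk I.goal) (S.map (actOf I)) = blk (I.flaw I.init S) := by
  -- The record starts as `[]` but is a full row of undefined values after a valid action. Both
  -- count as no violation, so the induction allows any such record `b`.
  suffices H : ∀ (s : I.State) (b : Block), allUndef b = true →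
      (if allUndef ((S.map (actOf I)).foldl run (blk fun v => some (s v), b)).2 then
        need (blk I.goal) ((S.map (actOf I)).foldl run (blk fun v => some (s v), b)).1
      else ((S.map (actOf I)).foldl run (blk fun v => some (s v), b)).2) = blk (I.flaw s S) from
    H I.init [] rfl
  induction S with
  | nil =>
    intro s b hb
    simp only [List.map_nil, List.foldl_nil, if_pos hb, need_blk, SASPlus.flaw]
  | cons a S ih =>
    intro s b hb
    have e : run (blk fun v => some (s v), b) (actOf I a) =
        (blk fun v => some (I.result a s v), blk (I.need (I.pre a) s)) := by
      rw [run, if_pos hb, actOf, applyEff_blk, need_blk]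
    rw [List.map_cons, List.foldl_cons, e, SASPlus.flaw]
    split_ifs with h1 h2 h2
    · have := ih (I.result a s) _ (allUndef_blk.2 h2)
      rwa [if_pos h1] at this
    · rw [foldl_run_of_ne (by rwa [allUndef_blk])] at h1
      exact absurd (allUndef_blk.1 h1) h2
    · have := ih (I.result a s) _ (allUndef_blk.2 h2)
      rwa [if_neg h1] at this
    · rw [foldl_run_of_ne (by rwa [allUndef_blk])]

variable (I)

/-- The expansions of a sequence of actions. -/
def expandActs (S : List (Fin I.numActs)) : List (List (Fin I.numActs)) :=
  (((List.finRange I.numActs).filter fun b =>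
    meets (blk (I.flaw I.init S)) (blk (I.eff b))).take 1).flatMap fun b => insertions b S

/-- The sequences of actions that the search visits in level `m`. -/
def levelActs : ℕ → List (List (Fin I.numActs))
  | 0 => [[]]
  | m + 1 => (levelActs m).flatMap (expandActs I)

variable {I}

theorem expand_blk (S : List (Fin I.numActs)) :
    expand (initBlk I) (blk I.goal) ((List.finRange I.numActs).map (actOf I)) (S.map (actOf I)) =
      (expandActs I S).map (List.map (actOf I)) := by
  simp only [expand, expandActs, flaw_blk, List.filter_map, ← List.map_take, List.flatMap_map,
    List.map_flatMap, insertions_map]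
  rfl

/-- The flag lags behind the list: it covers the levels below `u.length`, and the list is the
untested level `u.length`. This is why `k + 1` rounds test exactly the lengths up to `k`. -/
theorem levels_blk (l : List Block) (hi : initOf l = initBlk I) (hg : goalOf l = blk I.goal)
    (ha : actsOf l = (List.finRange I.numActs).map (actOf I)) (u : List Unit) :
    (levels l u).1 = (levelActs I u.length).map (List.map (actOf I)) ∧
      ((levels l u).2 = true ↔ ∃ j < u.length, ∃ S ∈ levelActs I j, I.IsPlan S) := by
  induction u using List.reverseRecOn with
  | nil => exact ⟨rfl, by simp [levels]⟩
  | append_singleton u x ih =>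
    have e : levels l (u ++ [x]) = level (initOf l) (goalOf l) (actsOf l) (levels l u) := by
      simp [levels]
    rw [e, level, ih.1, hi, hg, ha, List.length_append, List.length_singleton]
    constructor
    · simp only [List.flatMap_map, expand_blk, levelActs, List.map_flatMap]
    · simp only [Bool.or_eq_true, ih.2, List.any_map, List.any_eq_true, Function.comp_apply,
        flaw_blk, allUndef_blk, ← SASPlus.isPlan_iff, Nat.lt_succ_iff_lt_or_eq, or_and_right,
        exists_or, exists_eq_left]

theorem length_of_mem_levelActs {m : ℕ} {S : List (Fin I.numActs)} (h : S ∈ levelActs I m) :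
    S.length = m := by
  induction m generalizing S with
  | zero => simp [levelActs] at h; simp [h]
  | succ m ih =>
    simp only [levelActs, List.mem_flatMap, expandActs] at h
    obtain ⟨T, hT, b, -, hS⟩ := h
    obtain ⟨l₁, l₂, rfl, rfl⟩ := mem_insertions.1 hS
    have := ih hT
    simp only [List.length_append, List.length_cons] at this ⊢
    omega

/-- At most one action is inserted per sequence, so the branching is at most the number of places,
which `k + 2` bounds on all levels concerned. -/
theorem length_levelActs_le {k m : ℕ} (h : m ≤ k + 1) :
    (levelActs I m).length ≤ (k + 2) ^ m := by
  induction m with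
  | zero => simp [levelActs]
  | succ m ih =>
    have h1 := ih (by omega)
    have h2 : ∀ S ∈ levelActs I m, (expandActs I S).length ≤ k + 2 := by
      intro S hS
      unfold expandActs
      rcases (List.finRange I.numActs).filter _ with _ | ⟨b, t⟩
      · simp
      · simp only [List.take_succ_cons, List.take_zero, List.flatMap_cons, List.flatMap_nil,
          List.append_nil, length_insertions, length_of_mem_levelActs hS]
        omega
    rw [levelActs, List.length_flatMap, pow_succ]
    refine (List.sum_le_card_nsmul _ (k + 2) ?_).trans ?_
    · simpa using h2
    · rw [List.length_map, smul_eq_mul]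
      exact Nat.mul_le_mul_right _ h1

/-- This is the invariant of the search: until some plan is met, one branch stays inside `p`. -/
theorem exists_mem_levelActs (hP : I.RestrictionP) {p : List (Fin I.numActs)} (hp : I.IsPlan p)
    (m : ℕ) : (∃ j < m, ∃ S ∈ levelActs I j, I.IsPlan S) ∨
      ∃ S ∈ levelActs I m, S.Sublist p := by
  induction m with
  | zero => exact Or.inr ⟨[], by simp [levelActs], List.nil_sublist _⟩
  | succ m ih =>
    rcases ih with ⟨j, hj, h⟩ | ⟨S, hS, hsub⟩
    · exact Or.inl ⟨j, by omega, h⟩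
    · by_cases hplan : I.IsPlan S
      · exact Or.inl ⟨m, by omega, S, hS, hplan⟩
      · right
        rw [SASPlus.isPlan_iff] at hplan
        obtain ⟨v, hv⟩ := Function.ne_iff.1 hplan
        obtain ⟨x, hx⟩ := Option.ne_none_iff_exists'.1 hv
        obtain ⟨b, hb, -⟩ := hP.exists_insert hsub hp hx
        have hmem : b ∈ (List.finRange I.numActs).filter fun b =>
            meets (blk (I.flaw I.init S)) (blk (I.eff b)) := by
          rw [List.mem_filter]
          exact ⟨List.mem_finRange b, meets_blk.2 ⟨v, x, hx, hb⟩⟩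
        rcases hf : (List.finRange I.numActs).filter fun b =>
            meets (blk (I.flaw I.init S)) (blk (I.eff b)) with _ | ⟨b', t⟩
        · rw [hf] at hmem; simp at hmem
        · have hb' : b' ∈ (List.finRange I.numActs).filter fun b =>
            meets (blk (I.flaw I.init S)) (blk (I.eff b)) := by rw [hf]; simp
          -- `b` only shows that a candidate exists. The chosen `b'` may achieve a different missing
          -- value `y` of `w`, and the insertion argument is applied to that one.
          obtain ⟨w, y, hy, hb'⟩ := meets_blk.1 (List.mem_filter.1 hb').2
          obtain ⟨-, -, H⟩ := hP.exists_insert hsub hp hy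
          obtain ⟨S', hS', hsub'⟩ := H b' hb'
          refine ⟨S', ?_, hsub'⟩
          rw [levelActs, List.mem_flatMap]
          refine ⟨S, hS, ?_⟩
          rw [expandActs, hf]
          simpa using hS'

/-- The search finds a plan of length at most `k` if there is one. -/
theorem exists_levelActs_iff (hP : I.RestrictionP) (k : ℕ) :
    (∃ j < k + 1, ∃ S ∈ levelActs I j, I.IsPlan S) ↔
      ∃ p : List (Fin I.numActs), I.IsPlan p ∧ p.length ≤ k := by
  constructor
  · rintro ⟨j, hj, S, hS, h⟩
    exact ⟨S, h, by rw [length_of_mem_levelActs hS]; omega⟩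
  · rintro ⟨p, hp, hk⟩
    -- At this level a subsequence of `p` has the full length and hence equals `p`.
    rcases exists_mem_levelActs hP hp p.length with ⟨j, hj, h⟩ | ⟨S, hS, hsub⟩
    · exact ⟨j, by omega, h⟩
    · obtain rfl := hsub.eq_of_length (length_of_mem_levelActs hS)
      exact ⟨S.length, by omega, S, hS, hp⟩

end

/-! ### Parsing -/

/-- The fold reads from the right: the end marker opens an empty word in the current block, and the
digits are then put in front of it. -/
theorem parse_natCode (m : ℕ) (r : List PlanSymbol) :
    parse (natCode m ++ endValue :: r) =
      (natCode m :: (parse r).headI) :: (parse r).tail := by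
  have H : ∀ l : List Bool, parse (l.map bit ++ endValue :: r) =
      (l.map bit :: (parse r).headI) :: (parse r).tail := by
    intro l
    induction l with
    | nil => rfl
    | cons b l ih =>
      change parseStep (bit b) (parse (l.map bit ++ endValue :: r)) = _
      rw [ih]
      rfl
  exact H _

theorem parse_valueCode (o : Option ℕ) (r : List PlanSymbol) :
    parse (valueCode o ++ r) = (tokOf o :: (parse r).headI) :: (parse r).tail := by
  cases o with
  | none => rfl
  | some m =>
    rw [valueCode, List.append_assoc]
    exact parse_natCode m r

theorem parse_blockCode (l : List (Option ℕ)) (r : List PlanSymbol) :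
    parse (blockCode l ++ r) = l.map tokOf :: parse r := by
  unfold blockCode
  induction l with
  | nil => rfl
  | cons o l ih =>
    rw [List.flatMap_cons, List.append_assoc, List.append_assoc, parse_valueCode,
      ← List.append_assoc, ih]
    rfl

theorem parse_stateCode {n d : ℕ} (s : Fin n → Option (Fin d)) (r : List PlanSymbol) :
    parse (stateCode s ++ r) = blk s :: parse r := by
  rw [stateCode, parse_blockCode, List.map_ofFn]
  rfl

theorem parse_actions {I : SASPlus} (l : List (Fin I.numActs)) :
    parse (l.map fun a => stateCode (I.pre a) ++ stateCode (I.eff a)).flatten =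
      l.flatMap fun a => [blk (I.pre a), blk (I.eff a)] := by
  induction l with
  | nil => rfl
  | cons a l ih =>
    rw [List.map_cons, List.flatten_cons, List.append_assoc, parse_stateCode, parse_stateCode, ih]
    rfl

theorem parse_planCode (I : SASPlus) (k : ℕ) : parse (planCode I k) =
    [natCode k] :: [natCode I.domSize] :: initBlk I :: blk I.goal ::
      (List.finRange I.numActs).flatMap fun a => [blk (I.pre a), blk (I.eff a)] := by
  rw [planCode, parse_blockCode, parse_blockCode, parse_stateCode, parse_stateCode,
    List.ofFn_eq_map, parse_actions]
  rfl

/-- Read from the right, an effect comes first and waits for its precondition; nothing is left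
waiting at the end. -/
theorem pairUp_flatMap {β : Type} (f g : β → Block) (l : List β) :
    pairUp (l.flatMap fun a => [f a, g a]) = l.map fun a => (f a, g a) := by
  have H : (l.flatMap fun a => [f a, g a]).foldr (fun b (s : List Block × List Act) =>
      if s.1.isEmpty then ([b], s.2) else ([], (b, s.1.headI) :: s.2)) ([], []) =
      ([], l.map fun a => (f a, g a)) := by
    induction l with
    | nil => rfl
    | cons a l ih =>
      rw [List.flatMap_cons]
      simp only [List.cons_append, List.nil_append, List.foldr_cons, ih]
      rfl
  rw [pairUp, H]

/-- Binary words start with the least significant digit, so the right fold is Horner's scheme. -/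
theorem length_unary_natCode (k : ℕ) : (unary (natCode k)).length = k := by
  have H : ∀ p : PosNum,
      (unary ((Computability.encodePosNum p).map bit)).length = (p : ℕ) := by
    intro p
    induction p with
    | one => rfl
    | bit0 p ih =>
      rw [show unary ((Computability.encodePosNum p.bit0).map bit) =
        unary ((Computability.encodePosNum p).map bit) ++
          unary ((Computability.encodePosNum p).map bit) from rfl, List.length_append, ih,
        PosNum.cast_bit0]
    | bit1 p ih =>
      rw [show unary ((Computability.encodePosNum p.bit1).map bit) =
        () :: (unary ((Computability.encodePosNum p).map bit) ++
          unary ((Computability.encodePosNum p).map bit)) from rfl, List.length_cons,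
        List.length_append, ih, PosNum.cast_bit1]
  unfold natCode Computability.encodeNat
  have e : ((k : Num) : ℕ) = k := Num.to_of_nat k
  rcases hk : (k : Num) with _ | p
  · rw [hk] at e
    exact e
  · rw [hk] at e
    exact (H p).trans e

theorem actsOf_parse (I : SASPlus) (k : ℕ) :
    actsOf (parse (planCode I k)) = (List.finRange I.numActs).map (actOf I) := by
  rw [parse_planCode]
  exact pairUp_flatMap _ _ _

theorem decideWord_planCode {I : SASPlus} (hP : I.RestrictionP) (k : ℕ) :
    decideWord (planCode I k) = true ↔
      ∃ p : List (Fin I.numActs), I.IsPlan p ∧ p.length ≤ k := by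
  rw [decideWord, (levels_blk (I := I) (parse (planCode I k)) (by rw [parse_planCode]; rfl)
    (by rw [parse_planCode]; rfl) (actsOf_parse I k) _).2, ← exists_levelActs_iff hP]
  rw [List.length_cons, parse_planCode]
  change (∃ j < (unary (natCode k)).length + 1, _) ↔ _
  rw [length_unary_natCode]

/-- There are at most `(k + 2) ^ (k + 1)` sequences of at most `k + 1` actions, and each action is
an entry of the parsed list, whose size therefore bounds it. -/
theorem esize_levels_le (I : SASPlus) (k : ℕ) {u : List Unit} (hu : u.length ≤ k + 1) :
    esize (levels (parse (planCode I k)) u) ≤ (k + 2) ^ (k + 1) *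
      ((k + 1) * (esize (actsOf (parse (planCode I k))) + 1) + 2) + 5 := by
  have h := (levels_blk (I := I) (parse (planCode I k)) (by rw [parse_planCode]; rfl)
    (by rw [parse_planCode]; rfl) (actsOf_parse I k) u).1
  have e : esize (levels (parse (planCode I k)) u) =
    esize (levels (parse (planCode I k)) u).1 + esize (levels (parse (planCode I k)) u).2 + 1 := rfl
  have h3 := esize_bool_le (levels (parse (planCode I k)) u).2
  have h4 : esize (levels (parse (planCode I k)) u).1 ≤ (k + 2) ^ (k + 1) *
      ((k + 1) * (esize (actsOf (parse (planCode I k))) + 1) + 2) + 1 := by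
    change _ ≤ _ * ((k + 1) * (esize (actsOf (parse (planCode I k))) + 1) + 1 + 1) + 1
    rw [h]
    refine (esize_le_of_forall
      (B := (k + 1) * (esize (actsOf (parse (planCode I k))) + 1) + 1) fun S hS => ?_).trans ?_
    · obtain ⟨T, hT, rfl⟩ := List.mem_map.1 hS
      refine (esize_le_of_forall (B := esize (actsOf (parse (planCode I k))))
        fun a ha => ?_).trans ?_
      · obtain ⟨b, -, rfl⟩ := List.mem_map.1 ha
        refine (esize_lt_of_mem ?_).le
        rw [actsOf_parse]
        exact List.mem_map_of_mem (List.mem_finRange b)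
      · rw [List.length_map, length_of_mem_levelActs hT]
        gcongr
    · rw [List.length_map]
      gcongr
      exact (length_levelActs_le hu).trans (Nat.pow_le_pow_right (by omega) hu)
  omega

end PlanSearch

/-! ### From programs to machines -/

namespace Prog

/-- Push the symbols of a word on `tmp₁`, the first symbol first. -/
def pushTmp : List Bool → Prog
  | [] => nop
  | y :: w => .seq (.push tmp₁ y) (pushTmp w)

theorem exec_pushTmp {i : List PlanSymbol} {a b u c : List Bool} : ∀ (w t : List Bool),
    Exec (pushTmp w) (mk i a b t u c) (mk i a b (w.reverse ++ t) u c) (w.length + 2)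
  | [], _ => exec_nop.mono (by simp)
  | y :: w, t => by
    have h := exec_pushTmp (i := i) (a := a) (b := b) (u := u) (c := c) w (y :: t)
    rw [List.reverse_cons, List.append_assoc]
    exact (Exec.seq push_tmp₁ h).mono (by simp only [List.length_cons]; omega)

/-- Push the beginning of the code of a list of symbols, if its head is the top of the input and
is in `l`. -/
def pushSymbol : List PlanSymbol → Prog
  | [] => nop
  | s :: l => .ite inp (fun o => decide (o = some s)) (pushTmp (true :: (enc s).code))
      (pushSymbol l)

theorem exec_pushSymbol {s : PlanSymbol} {i : List PlanSymbol} {a b t u c : List Bool} :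
    ∀ l : List PlanSymbol, s ∈ l → Exec (pushSymbol l) (mk (s :: i) a b t u c)
      (mk (s :: i) a b ((true :: (enc s).code).reverse ++ t) u c) (l.length + esize s + 3)
  | s' :: l, h => by
    by_cases hs : s = s'
    · subst hs
      refine (Exec.ite_true (by simp [Stk.mk]) (exec_pushTmp _ t)).mono ?_
      simp only [List.length_cons, Bin.length_code, esize]; omega
    · have h1 := exec_pushSymbol (i := i) (a := a) (b := b) (t := t) (u := u) (c := c) l
        ((List.mem_cons.1 h).resolve_left hs)
      refine (Exec.ite_false (by simp [Stk.mk, hs]) h1).mono ?_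
      simp only [List.length_cons]; omega

/-- Move the input to `main`, encoded as a tree. -/
def load : Prog := .seq
  (.loop inp Option.isSome (.seq
    (pushSymbol [.bit false, .bit true, .undef, .endValue, .endBlock]) (.pop inp)))
  (.seq (.push tmp₁ false) (drain fun y => .push main y))

/-- Each symbol contributes a node mark and its own code, and the closing `false` is the empty list.
All this lies in reverse on `tmp₁`, and draining restores preorder. -/
theorem exec_load (w : List PlanSymbol) : Exec load (mk w [] [] [] [] [])
    (mk [] (enc w).code [] [] [] []) (20 * esize w + 20) := by
  have H : ∀ (w : List PlanSymbol) (t : List Bool), ∃ t', t'.reverse ++ [false] =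
      t.reverse ++ (enc w).code ∧
      Exec (.loop inp Option.isSome (.seq
        (pushSymbol [.bit false, .bit true, .undef, .endValue, .endBlock]) (.pop inp)))
        (mk w [] [] t [] []) (mk [] [] [] t' [] []) (5 * esize w + 10 * w.length + 1) := by
    intro w
    induction w with
    | nil => exact fun t => ⟨t, rfl, .mono (.loop_exit rfl) (by omega)⟩
    | cons s w ih =>
      intro t
      have hs : s ∈ [PlanSymbol.bit false, .bit true, .undef, .endValue, .endBlock] := by
        rcases s with ⟨_ | _⟩ | _ | _ | _ <;> simp
      obtain ⟨t', h1, h2⟩ := ih ((true :: (enc s).code).reverse ++ t)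
      refine ⟨t', ?_, (Exec.loop_step rfl (.seq (exec_pushSymbol _ hs) pop_inp) h2).mono ?_⟩
      · rw [h1, List.reverse_append, List.reverse_reverse, List.append_assoc]
        rfl
      · simp only [List.length_cons, List.length_nil, esize_cons]; omega
  obtain ⟨t, h1, h2⟩ := H w []
  have h3 := drain_main (i := []) (a := []) (b := []) (t := false :: t) (u := []) (c := [])
  have e : (false :: t).reverse ++ [] = (enc w).code := by
    rw [List.append_nil, List.reverse_cons, h1]; rfl
  rw [e] at h3
  have hl : t.length + 1 = esize w := by
    have := congrArg List.length e
    simpa [esize] using this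
  have hw := length_lt_esize w
  refine (Exec.seq h2 (.seq push_tmp₁ h3)).mono ?_
  simp only [List.length_cons]
  omega

/-- Replace the tree of a truth value by the truth value. -/
def finish : Prog := .ite main isTrue
  (.seq (.pop main) (.seq (.pop main) (.seq (.pop main) (.push main true)))) nop

theorem exec_finish (b : Bool) : Exec finish (mk [] (enc b).code [] [] [] [])
    (mk [] [b] [] [] [] []) 5 := by
  cases b
  · exact (Exec.ite_false rfl exec_nop).mono (by omega)
  · exact Exec.ite_true rfl (.seq pop_main (.seq pop_main (.seq pop_main push_main)))

end Prog

/-- The machine of a program. -/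
def Prog.machine (p : Prog) : Turing.TM2ComputableAux PlanSymbol Bool where
  tm := (StackProg.seq Prog.load (.seq p Prog.finish)).toTM2 inp main
  inputAlphabet := Equiv.refl PlanSymbol
  outputAlphabet := Equiv.refl Bool

/-- The constant 26 is 20 steps from loading, 5 from `finish` and 1 for halting. -/
theorem Prog.Computes.machine {p : Prog} {w : List PlanSymbol} {b : Bool} {n m : ℕ}
    (h : p.Computes (enc w) (enc b) n) (hm : 20 * esize w + n + 26 ≤ m) :
    Nonempty (Turing.TM2OutputsInTime p.machine.tm (w.map p.machine.inputAlphabet.symm)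
      (some ([b].map p.machine.outputAlphabet.symm)) m) := by
  have h1 := h [] [] []
  rw [List.append_nil, List.append_nil] at h1
  have h2 := (Exec.seq (exec_load w) (.seq h1 (exec_finish b)))
  have ei : mk w [] [] [] [] [] = Function.update (fun k => ([] : List (Sym k))) inp w := by
    funext k; cases k <;> rfl
  have eo : mk [] [b] [] [] [] [] = Function.update (fun k => ([] : List (Sym k))) main [b] := by
    funext k; cases k <;> rfl
  rw [ei, eo] at h2
  obtain ⟨H⟩ := h2.evalsTo
  have e1 : w.map p.machine.inputAlphabet.symm = w := List.map_id w
  rw [e1]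
  exact ⟨⟨H.toEvalsTo, H.steps_le_m.trans (by omega)⟩⟩

/-! ### The main theorem -/

/-- An instance and its word have the same tree, so passing from one to the other takes no work. -/
instance : Enc boundedPlanExistenceP.Instance where
  enc x := enc (PlanSymbol.planCode x.1.1.1 x.1.1.2)
  enc_injective _ _ h := boundedPlanExistenceP.encode_injective
    (enc_injective (α := List PlanSymbol) h)

namespace PlanSearch

open PlanSymbol

/-- The word of an instance. -/
def word (x : boundedPlanExistenceP.Instance) : List PlanSymbol := planCode x.1.1.1 x.1.1.2

/-- The allowance for the number of action sequences that are visited. -/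
def allowance (x : boundedPlanExistenceP.Instance) : ℕ := (x.1.1.2 + 2) ^ (x.1.1.2 + 1)

/-- The allowance dominates both `k`, and with it the unary counter, and the number of sequences on
a level, so `esize_levels_le` becomes a polynomial bound. -/
theorem decide_ftime : FTime allowance fun x => decideWord (word x) := by
  have hw : PTime word := .of_enc_eq fun _ => rfl
  have hw' : FTime allowance word := .of_enc_eq fun _ => rfl
  have h2 := two_le_meas allowance
  have hA : PolyBdd (meas allowance) allowance :=
    PolyBdd.self.mono fun a => by unfold meas; omega
  have hk : PolyBdd (meas allowance) fun x => x.1.1.2 := hA.mono fun x => by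
    unfold allowance
    have h1 : x.1.1.2 + 2 ≤ (x.1.1.2 + 2) ^ (x.1.1.2 + 1) := Nat.le_self_pow (by omega) _
    omega
  have hacts : PolyBdd (meas allowance) fun x => esize (actsOf (parse (word x))) :=
    (FTime.pairUp (FTime.parse hw').tail.tail.tail.tail).esize_bdd
  have hlen : ∀ x, (unary (parse (word x)).headI.headI).length = x.1.1.2 := fun x => by
    rw [word, parse_planCode]
    exact length_unary_natCode _
  refine FTime.decideWord hw (hk.mono fun x => (hlen x).le)
    (B := fun x => allowance x * ((x.1.1.2 + 1) * (esize (actsOf (parse (word x))) + 1) + 2) + 5)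
    ((hA.mul (((hk.add h2 (.const h2 1)).mul (hacts.add h2 (.const h2 1))).add h2
      (.const h2 2))).add h2 (.const h2 5)) fun x u hu => ?_
  rw [hlen] at hu
  exact esize_levels_le _ _ hu

theorem four_le_size (x : boundedPlanExistenceP.Instance) : 4 ≤ boundedPlanExistenceP.size x := by
  change 4 ≤ (planCode x.1.1.1 x.1.1.2).length
  simp only [planCode, stateCode, blockCode, List.length_append, List.length_singleton]
  omega

theorem esize_word_le (x : boundedPlanExistenceP.Instance) :
    esize (word x) ≤ 10 * boundedPlanExistenceP.size x + 1 := by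
  have h : ∀ s ∈ word x, esize s ≤ 9 := fun s _ => by
    rcases s with ⟨_ | _⟩ | _ | _ | _ <;> decide
  refine (esize_le_of_forall h).trans_eq ?_
  rw [mul_comm]
  rfl

/-- If `c ≤ k + 1`, then `(k + 1) * c ≤ (k + 1) ^ 2`. Otherwise `k` is bounded in terms of `c`, and
the left side is at most a number depending only on `c`, which is put into the last factor. -/
theorem pow_le_bound (k c : ℕ) : ((k + 2) ^ (k + 1)) ^ c ≤
    (2 * 2 ^ ((k + 2) ^ 2) * (k + 2) ^ ((k + 1) ^ 2)) * 2 ^ ((c + 2) ^ (c * c)) := by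
  rw [← pow_mul]
  by_cases h : c ≤ k + 1
  · have h1 : (k + 2) ^ ((k + 1) * c) ≤ (k + 2) ^ ((k + 1) ^ 2) :=
      Nat.pow_le_pow_right (by omega) (by rw [sq]; exact Nat.mul_le_mul_left _ h)
    calc (k + 2) ^ ((k + 1) * c) ≤ 1 * (k + 2) ^ ((k + 1) ^ 2) * 1 := by simpa using h1
      _ ≤ _ := by
        gcongr
        · exact Nat.one_le_iff_ne_zero.2 (by positivity)
        · exact Nat.one_le_two_pow
  · have h1 : (k + 2) ^ ((k + 1) * c) ≤ (c + 2) ^ (c * c) := by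
      calc (k + 2) ^ ((k + 1) * c) ≤ (c + 2) ^ ((k + 1) * c) :=
            Nat.pow_le_pow_left (by omega) _
        _ ≤ _ := Nat.pow_le_pow_right (by omega) (Nat.mul_le_mul_right _ (by omega))
    calc (k + 2) ^ ((k + 1) * c) ≤ 1 * 2 ^ ((c + 2) ^ (c * c)) := by
          rw [one_mul]; exact h1.trans Nat.lt_two_pow_self.le
      _ ≤ _ := by
        gcongr
        exact Nat.one_le_iff_ne_zero.2 (by positivity)

theorem solvable : boundedPlanExistenceP.SolvableInFPTTime
    (fun k => 2 * 2 ^ ((k + 2) ^ 2) * (k + 2) ^ ((k + 1) ^ 2)) := by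
  obtain ⟨p, t, ht, -, hp⟩ := decide_ftime
  have h2 := two_le_meas allowance
  have hT : PolyBdd (meas allowance) fun x => 20 * esize x + t x + 26 :=
    (((PolyBdd.const h2 20).mul FTime.bdd_id).add h2 ht).add h2 (.const h2 26)
  obtain ⟨c, hc⟩ := hT
  -- The summand `4 * c` comes from `n ^ 4` in `hm`; the other turns the constant of `pow_le_bound`
  -- into a power of `n`, as `2 ≤ n`.
  refine ⟨4 * c + (c + 2) ^ (c * c), p.machine, fun x => ⟨decideWord (word x), ?_, ?_⟩⟩
  · exact decideWord_planCode x.2 x.1.1.2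
  · refine (hp x).machine (w := word x) ((hc x).trans ?_)
    have h4 := four_le_size x
    have hs := esize_word_le x
    set n := boundedPlanExistenceP.size x
    set k := boundedPlanExistenceP.param x
    -- A product is needed to separate `n` from `k`. Since `n ≥ 4`, the factor `n ^ 4 ≥ 64 * n`
    -- leaves ample room for `10 * n + 3` plus the allowance.
    have hm : meas allowance x ≤ n ^ 4 * (k + 2) ^ (k + 1) := by
      change esize (word x) + (k + 2) ^ (k + 1) + 2 ≤ _
      have h5 : 1 ≤ (k + 2) ^ (k + 1) := Nat.one_le_iff_ne_zero.2 (by positivity)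
      have h6 : 64 * n ≤ n ^ 4 := by
        calc 64 * n = 4 ^ 3 * n := by norm_num
          _ ≤ n ^ 3 * n := by gcongr
          _ = n ^ 4 := by ring
      generalize (k + 2) ^ (k + 1) = P at h5 ⊢
      generalize n ^ 4 = Q at h6 ⊢
      nlinarith
    calc meas allowance x ^ c ≤ (n ^ 4 * (k + 2) ^ (k + 1)) ^ c := Nat.pow_le_pow_left hm c
      _ = n ^ (4 * c) * ((k + 2) ^ (k + 1)) ^ c := by rw [mul_pow, ← pow_mul]
      _ ≤ n ^ (4 * c) * ((2 * 2 ^ ((k + 2) ^ 2) * (k + 2) ^ ((k + 1) ^ 2)) *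
          2 ^ ((c + 2) ^ (c * c))) := Nat.mul_le_mul_left _ (pow_le_bound k c)
      _ ≤ n ^ (4 * c) * ((2 * 2 ^ ((k + 2) ^ 2) * (k + 2) ^ ((k + 1) ^ 2)) *
          n ^ ((c + 2) ^ (c * c))) := by gcongr; omega
      _ = (2 * 2 ^ ((k + 2) ^ 2) * (k + 2) ^ ((k + 1) ^ 2)) *
          n ^ (4 * c + (c + 2) ^ (c * c)) := by rw [pow_add]; ring

theorem computable_bound :
    Computable fun k : ℕ => 2 * 2 ^ ((k + 2) ^ 2) * (k + 2) ^ ((k + 1) ^ 2) := by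
  have hpow : Primrec₂ fun a b : ℕ => a ^ b := by
    have h : Primrec₂ fun a b : ℕ => Nat.rec (motive := fun _ => ℕ) 1 (fun _ r => r * a) b :=
      Primrec.nat_rec (Primrec.const 1)
        (Primrec.nat_mul.comp (Primrec.snd.comp Primrec.snd) Primrec.fst).to₂
    refine h.of_eq fun a b => ?_
    induction b with
    | zero => rfl
    | succ b ih => rw [pow_succ, ← ih]
  have hadd : ∀ m : ℕ, Primrec fun k : ℕ => k + m := fun m =>
    Primrec.nat_add.comp Primrec.id (Primrec.const m)
  exact (Primrec.nat_mul.comp (Primrec.nat_mul.comp (Primrec.const 2)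
    (hpow.comp (Primrec.const 2) (hpow.comp (hadd 2) (Primrec.const 2))))
    (hpow.comp (hadd 2) (hpow.comp (hadd 1) (Primrec.const 2)))).to_comp

end PlanSearch

theorem mainTheorem1 :
    boundedPlanExistenceP.InFPT ∧
      boundedPlanExistenceP.SolvableInFPTTime
        (fun k => 2 * 2 ^ ((k + 2) ^ 2) * (k + 2) ^ ((k + 1) ^ 2)) :=
  ⟨⟨_, PlanSearch.computable_bound, PlanSearch.solvable⟩, PlanSearch.solvable⟩
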